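/- Setting. Let $\mathcal N$ be a countable set of variables. A (proper) state $\sigma$ is a finite partial map $\mathcal N\rightharpoonup\mathbb R$; $\Omega$ is the set of states with the Borel $\sigma$-algebra of the extended metric $d(\sigma,\tau)=\sum_{x\in\mathrm{dom}\,\sigma}|\sigma(x)-\tau(x)|$ if $\mathrm{dom}\,\sigma=\mathrm{dom}\,\tau$ and $\infty$ otherwise. $\hat\Omega=\Omega\uplus\{\lightning,\uparrow\}$ carries the Borel $\sigma$-algebra of the extension of $d$ in which $\lightning$ (error) and $\uparrow$ (divergence) have distance $\infty$ from all other points. Real-valued expressions $E$ and predicates $\phi$ come from an arbitrary syntax with total evaluation functions $\sigma\mapsto\sigma(E)\in\mathbb R$, $\sigma\mapsto\sigma(\phi)\in\{\mathtt{true},\mathtt{false}\}$ that are measurable for every $E$ and $\phi$. PL programs are $$C::=\mathtt{skip}\mid\mathtt{diverge}\mid x:=E\mid x:\approx U\mid\mathtt{observe}(\phi)\mid\mathtt{score}(E)\mid C;C\mid\mathtt{if}(\phi)\{C\}\mid\mathtt{while}(\phi)\{C\}.$$ Weakest preexpectation. For measurable $f:\Omega\to[0,\infty]$, with Iverson brackets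 $[\cdot]$ and $0\cdot\infty=0$: $\mathtt{wp}[\![\mathtt{skip}]\!](f)=f$; $\mathtt{wp}[\![\mathtt{diverge}]\!](f)=0$; $\mathtt{wp}[\![x:=E]\!](f)(\sigma)=f(\sigma[x\mapsto\sigma(E)])$; $\mathtt{wp}[\![x:\approx U]\!](f)(\sigma)=\int_{[0,1]}f(\sigma[x\mapsto v])\,dv$; $\mathtt{wp}[\![\mathtt{observe}(\phi)]\!](f)(\sigma)=[\sigma(\phi)]f(\sigma)$; $\mathtt{wp}[\![\mathtt{score}(E)]\!](f)(\sigma)=[\sigma(E)\in(0,1]]\,\sigma(E)f(\sigma)$; $\mathtt{wp}[\![C_1;C_2]\!](f)=\mathtt{wp}[\![C_1]\!](\mathtt{wp}[\![C_2]\!](f))$; $\mathtt{wp}[\![\mathtt{if}(\phi)\{C\}]\!](f)=[\phi]\,\mathtt{wp}[\![C]\!](f)+[\neg\phi]f$; and $\mathtt{wp}[\![\mathtt{while}(\phi)\{C\}]\!](f)$ is the least fixpoint, among measurable functions $\Omega\to[0,\infty]$ ordered pointwise, of $X\mapsto[\neg\phi]f+[\phi]\,\mathtt{wp}[\![C]\!](X)$.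 Entropy. Let $(\mathbb S,\mathcal S,\mu)$ be any entropy space: a probability space with measurable maps $\pi_U:\mathbb S\to[0,1]$, $\pi_L,\pi_R:\mathbb S\to\mathbb S$ and a surjective measurable map $(::):\mathbb S\times\mathbb S\to\mathbb S$ such that $\pi_L(a::b)=a$, $\pi_R(a::b)=b$, $\int f(\pi_U(\theta))\,\mu(d\theta)=\int_{[0,1]}f(x)\,dx$ and $\int g(\pi_L(\theta),\pi_R(\theta))\,\mu(d\theta)=\iint g(\theta_L,\theta_R)\,\mu(d\theta_L)\mu(d\theta_R)$ for all measurable $f:[0,1]\to[0,\infty]$, $g:\mathbb S\times\mathbb S\to[0,\infty]$. Operational semantics. Configurations are tuples $\langle\theta,C,K,\sigma,\theta_K,n,w\rangle$ with entropies $\theta,\theta_K\in\mathbb S$, a program $C$, a list $K$ of programs, a state $\sigma$ or $\lightning$, a step count $n\in\mathbb N$ and a weight $w$. Let $\downarrow$ mark a completed statement; $\mathtt{skip}$ is identified with $\downarrow$, and sequential composition is read up to associativity. Every rule requires $\sigma\ne\lightning$ and turns $n$ into $n+1$; components not mentioned are unchanged: (diverge) $\mathtt{diverge}$ reduces to itself;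 (assign) $x:=E$ becomes $\downarrow$, $\sigma$ becomes $\sigma[x\mapsto\sigma(E)]$; (draw) $x:\approx U$ becomes $\downarrow$, $\sigma$ becomes $\sigma[x\mapsto\pi_U(\pi_L(\theta))]$, $\theta$ becomes $\pi_R(\theta)$; (observe) $\mathtt{observe}(\phi)$ becomes $\downarrow$, and if $\sigma(\phi)=\mathtt{false}$ also $\sigma$ becomes $\lightning$ and $K$ becomes $[]$; (score) if $\sigma(E)\in(0,1]$, $\mathtt{score}(E)$ becomes $\downarrow$ and $w$ becomes $w\cdot\sigma(E)$; (seq) $C_1;C_2$ with $C_1$ not a sequence becomes $C_1$, $K$ becomes $C_2::K$, $\theta$ becomes $\pi_L(\theta)$, $\theta_K$ becomes $\pi_R(\theta)::\theta_K$; (pop) for statement $\downarrow$ and continuation $C::K$, the statement becomes $C$, the continuation $K$, $\theta$ becomes $\pi_L(\theta_K)$, $\theta_K$ becomes $\pi_R(\theta_K)$; (if) $\mathtt{if}(\phi)\{C\}$ becomes $C$ if $\sigma(\phi)=\mathtt{true}$ and $\downarrow$ otherwise; (while) $\mathtt{while}(\phi)\{C\}$ becomes $C;\mathtt{while}(\phi)\{C\}$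 if $\sigma(\phi)=\mathtt{true}$ and $\downarrow$ otherwise; (final) statement $\downarrow$ with $K=[]$ reduces to itself. Fix an arbitrary dummy entropy $\theta_K$ and start from $\langle\theta,C,[],\sigma,\theta_K,0,1\rangle$, $\sigma\in\Omega$. Let $\mathbf O_C^\sigma(\theta)\in\hat\Omega$ be $\tau$ if a configuration with statement $\downarrow$, continuation $[]$, state $\tau\in\Omega$ and continuation entropy $\theta_K$ is reached, $\lightning$ if an irreducible configuration is reached, and $\uparrow$ otherwise. Let $\mathbf{SC}_C^\sigma(\theta,n)$ be the weight of the configuration with step count $n$ if one is reached and its state is not $\lightning$, and $0$ otherwise, and let $\mathbf{SC}_C^\sigma(\theta)=\inf_n\mathbf{SC}_C^\sigma(\theta,n)=\lim_n\mathbf{SC}_C^\sigma(\theta,n)$. Let $[\![C]\!]_\sigma(A)=\int[\mathbf O_C^\sigma(\theta)\in A]\,\mathbf{SC}_C^\sigma(\theta)\,\mu(d\theta)$, i.e. the push-forward under $\mathbf O_C^\sigma$ of the measure with density $\mathbf{SC}_C^\sigma$ with respect to $\mu$. Theorem. For every measurable $f:\Omega\to[0,\infty]$, every PL program $C$ and every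 initial state $\sigma\in\Omega$, the functions $\mathbf O_C^\sigma$ and $\mathbf{SC}_C^\sigma$ are measurable (so that $[\![C]\!]_\sigma$ is a well-defined measure on $\hat\Omega$), and $$\mathtt{wp}[\![C]\!](f)(\sigma)=\int_{\Omega}f(\tau)\,[\![C]\!]_\sigma(d\tau),$$ where the integral is with respect to the restriction of $[\![C]\!]_\sigma$ to the proper states $\Omega$. -/

import Mathlib

open MeasureTheory
open scoped ENNReal NNReal

noncomputable section

namespace PL

/-! ### Program states -/

/-- A program state: a finite set of pairs `(x, V)` of a variable name and a real value, in which
every name occurs at most once. `σ.keys` is the domain of `σ`, `σ.lookup x` is the value of `x`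
(`none` off the domain), and `σ.insert x V` is the updated state `σ[x ↦ V]`. -/
abbrev State (N : Type*) : Type _ := Finmap (fun _ : N => ℝ)

section StateMetric

variable {N : Type*} [DecidableEq N]

/-- The value of a variable as a real number (only used for variables in the domain). -/
def State.val (σ : State N) (x : N) : ℝ := (σ.lookup x).getD 0

/-- The Manhattan distance for states with equal domains, `∞` otherwise. -/
def State.dist (σ τ : State N) : ℝ≥0∞ :=
  if σ.keys = τ.keys then ∑ x ∈ σ.keys, ENNReal.ofReal |σ.val x - τ.val x| else ⊤

instance : EMetricSpace (State N) where
  edist := State.dist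
  edist_self σ := by simp [State.dist]
  edist_comm σ τ := by
    unfold State.dist
    by_cases h : σ.keys = τ.keys
    · simp [h, abs_sub_comm]
    · rw [if_neg h, if_neg (Ne.symm h)]
  edist_triangle σ τ ρ := by
    unfold State.dist
    by_cases h : σ.keys = τ.keys
    · by_cases h' : τ.keys = ρ.keys
      · rw [if_pos h, if_pos h', if_pos (h.trans h'), h, ← Finset.sum_add_distrib]
        refine Finset.sum_le_sum fun x _ => ?_
        rw [← ENNReal.ofReal_add (abs_nonneg _) (abs_nonneg _)]
        exact ENNReal.ofReal_le_ofReal (abs_sub_le _ _ _)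
      · simp [h']
    · simp [h]
  eq_of_edist_eq_zero := by
    intro σ τ h
    change State.dist σ τ = 0 at h
    unfold State.dist at h
    split_ifs at h with hk
    · rw [Finset.sum_eq_zero_iff] at h
      refine Finmap.ext_lookup fun x => ?_
      by_cases hx : x ∈ σ.keys
      · have h1 := h x hx
        rw [ENNReal.ofReal_eq_zero] at h1
        have h2 : σ.val x = τ.val x :=
          sub_eq_zero.mp (abs_eq_zero.mp (le_antisymm h1 (abs_nonneg _)))
        obtain ⟨a, ha⟩ := Finmap.mem_iff.mp (Finmap.mem_keys.mp hx)
        obtain ⟨b, hb⟩ := Finmap.mem_iff.mp (Finmap.mem_keys.mp (hk ▸ hx))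
        simp only [State.val, ha, hb, Option.getD_some] at h2
        rw [ha, hb, h2]
      · rw [Finmap.lookup_eq_none.mpr (fun h' => hx (Finmap.mem_keys.mpr h')),
          Finmap.lookup_eq_none.mpr (fun h' => hx (hk ▸ Finmap.mem_keys.mpr h'))]
    · exact absurd h ENNReal.top_ne_zero

/-- The Borel σ-algebra of the metric on states. -/
instance : MeasurableSpace (State N) := borel (State N)

instance : BorelSpace (State N) := ⟨rfl⟩

end StateMetric

/-- Extended states: proper states, the error state (failed observation or evaluation error), and
the divergence state. -/
inductive ExtState (N : Type*) where
  | proper (σ : State N) : ExtState N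
  | error : ExtState N
  | div : ExtState N

section ExtStateMetric

variable {N : Type*} [DecidableEq N]

/-- The metric on states, extended by making the two exceptional states isolated points at
infinite distance from everything else. -/
def ExtState.dist : ExtState N → ExtState N → ℝ≥0∞
  | .proper σ, .proper τ => edist σ τ
  | .error, .error => 0
  | .div, .div => 0
  | _, _ => ⊤

instance : EMetricSpace (ExtState N) where
  edist := ExtState.dist
  edist_self a := by cases a <;> simp [ExtState.dist]
  edist_comm a b := by cases a <;> cases b <;> simp [ExtState.dist, edist_comm]
  edist_triangle a b c := by
    cases a <;> cases b <;> cases c <;> simp [ExtState.dist, edist_triangle]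
  eq_of_edist_eq_zero := by
    intro a b h
    change ExtState.dist a b = 0 at h
    cases a <;> cases b <;> simp_all [ExtState.dist]

/-- The Borel σ-algebra of the metric on extended states. -/
instance : MeasurableSpace (ExtState N) := borel (ExtState N)

instance : BorelSpace (ExtState N) := ⟨rfl⟩

end ExtStateMetric

/-! ### Syntax -/

/-- A language of arithmetic expressions and predicates over the program variables: the syntax is
arbitrary, evaluation is total, and evaluating a fixed expression or predicate is measurable in the
state. -/
structure ExprLang (N : Type*) [DecidableEq N] where
  Expr : Type*
  Pred : Type*
  evalE : Expr → State N → ℝ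
  evalP : Pred → State N → Bool
  measurable_evalE : ∀ E, Measurable (evalE E)
  measurable_evalP : ∀ φ, Measurable (evalP φ)

variable {N : Type*} [DecidableEq N]

/-- Programs. `draw x` is the random assignment `x :≈ U`, `cond φ C` is `if(φ){C}` (no `else`),
`loop φ C` is `while(φ){C}`. -/
inductive Prog (L : ExprLang N) where
  | skip : Prog L
  | diverge : Prog L
  | assign (x : N) (E : L.Expr) : Prog L
  | draw (x : N) : Prog L
  | observe (φ : L.Pred) : Prog L
  | score (E : L.Expr) : Prog L
  | seq (C₁ C₂ : Prog L) : Prog L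
  | cond (φ : L.Pred) (C : Prog L) : Prog L
  | loop (φ : L.Pred) (C : Prog L) : Prog L

/-! ### Weakest preexpectations -/

open Classical in
/-- Iverson brackets. -/
def iverson (p : Prop) : ℝ≥0∞ := if p then 1 else 0

/-- Least fixpoint in the pointwise ordered set of measurable functions: the pointwise infimum of
all measurable fixpoints, which is the least one as soon as there is a least one. -/
def lfpMeasurable (Φ : (State N → ℝ≥0∞) → (State N → ℝ≥0∞)) : State N → ℝ≥0∞ :=
  sInf {X | Measurable X ∧ Φ X = X}

/-- The weakest preexpectation transformer. -/
def wp {L : ExprLang N} : Prog L → (State N → ℝ≥0∞) → (State N → ℝ≥0∞)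
  | .skip, f => f
  | .diverge, _ => 0
  | .assign x E, f => fun σ => f (σ.insert x (L.evalE E σ))
  | .draw x, f => fun σ => ∫⁻ v in Set.Icc (0 : ℝ) 1, f (σ.insert x v)
  | .observe φ, f => fun σ => iverson (L.evalP φ σ = true) * f σ
  | .score E, f => fun σ =>
      iverson (L.evalE E σ ∈ Set.Ioc (0 : ℝ) 1) * ENNReal.ofReal (L.evalE E σ) * f σ
  | .seq C₁ C₂, f => wp C₁ (wp C₂ f)
  | .cond φ C, f => fun σ =>
      iverson (L.evalP φ σ = true) * wp C f σ + iverson (L.evalP φ σ = false) * f σ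
  | .loop φ C, f => lfpMeasurable fun X σ =>
      iverson (L.evalP φ σ = false) * f σ + iverson (L.evalP φ σ = true) * wp C X σ

/-! ### Entropy spaces -/

/-- An entropy space structure on the measurable space `S`. -/
structure EntropySpace (S : Type*) [MeasurableSpace S] where
  μ : Measure S
  measure_univ : μ Set.univ = 1
  πU : S → unitInterval
  πL : S → S
  πR : S → S
  pair : S → S → S
  measurable_πU : Measurable πU
  measurable_πL : Measurable πL
  measurable_πR : Measurable πR
  measurable_pair : Measurable fun p : S × S => pair p.1 p.2
  lintegral_πU : ∀ f : unitInterval → ℝ≥0∞, Measurable f →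
    ∫⁻ θ, f (πU θ) ∂μ = ∫⁻ x, f x ∂(volume : Measure unitInterval)
  πL_pair : ∀ a b, πL (pair a b) = a
  πR_pair : ∀ a b, πR (pair a b) = b
  pair_surjective : Function.Surjective fun p : S × S => pair p.1 p.2
  lintegral_πL_πR : ∀ g : S × S → ℝ≥0∞, Measurable g →
    ∫⁻ θ, g (πL θ, πR θ) ∂μ = ∫⁻ θR, ∫⁻ θL, g (θL, θR) ∂μ ∂μ

/-! ### Small-step operational semantics -/

/-- `Splits C C₁ C₂` says that `C` is, up to associativity of sequential composition, the sequence
`C₁; C₂` where `C₁` is not itself a sequence. -/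
inductive Splits {L : ExprLang N} : Prog L → Prog L → Prog L → Prop
  | base (C₁ C₂ : Prog L) (h : ∀ A B, C₁ ≠ .seq A B) : Splits (.seq C₁ C₂) C₁ C₂
  | assoc (C D A B : Prog L) (h : Splits C A B) : Splits (.seq C D) A (.seq B D)

/-- Configurations `⟨θ, C, K, σ, θ_K, n, w⟩`. The statement `skip`, which does nothing, also serves
as the marker `↓` of a completely evaluated statement. -/
structure Config (L : ExprLang N) (S : Type*) where
  entropy : S
  stmt : Prog L
  cont : List (Prog L)
  state : ExtState N
  contEntropy : S
  steps : ℕ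
  weight : ℝ≥0

/-- The one-step reduction relation on configurations. No rule applies in an exceptional state. -/
inductive Step {L : ExprLang N} {S : Type*} [MeasurableSpace S] (𝓔 : EntropySpace S) :
    Config L S → Config L S → Prop
  | diverge (θ K σ θK n w) :
      Step 𝓔 ⟨θ, .diverge, K, .proper σ, θK, n, w⟩ ⟨θ, .diverge, K, .proper σ, θK, n + 1, w⟩
  | assign (θ x E K σ θK n w) :
      Step 𝓔 ⟨θ, .assign x E, K, .proper σ, θK, n, w⟩
        ⟨θ, .skip, K, .proper (σ.insert x (L.evalE E σ)), θK, n + 1, w⟩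
  | draw (θ x K σ θK n w) :
      Step 𝓔 ⟨θ, .draw x, K, .proper σ, θK, n, w⟩
        ⟨𝓔.πR θ, .skip, K, .proper (σ.insert x (𝓔.πU (𝓔.πL θ) : ℝ)), θK, n + 1, w⟩
  | condition_true (θ φ K σ θK n w) (h : L.evalP φ σ = true) :
      Step 𝓔 ⟨θ, .observe φ, K, .proper σ, θK, n, w⟩ ⟨θ, .skip, K, .proper σ, θK, n + 1, w⟩
  | condition_false (θ φ K σ θK n w) (h : L.evalP φ σ = false) :
      Step 𝓔 ⟨θ, .observe φ, K, .proper σ, θK, n, w⟩ ⟨θ, .skip, [], .error, θK, n + 1, w⟩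
  | score (θ E K σ θK n w) (h : L.evalE E σ ∈ Set.Ioc (0 : ℝ) 1) :
      Step 𝓔 ⟨θ, .score E, K, .proper σ, θK, n, w⟩
        ⟨θ, .skip, K, .proper σ, θK, n + 1, w * (L.evalE E σ).toNNReal⟩
  | seq (θ C C₁ C₂ K σ θK n w) (h : Splits C C₁ C₂) :
      Step 𝓔 ⟨θ, C, K, .proper σ, θK, n, w⟩
        ⟨𝓔.πL θ, C₁, C₂ :: K, .proper σ, 𝓔.pair (𝓔.πR θ) θK, n + 1, w⟩
  | pop (θ C K σ θK n w) :
      Step 𝓔 ⟨θ, .skip, C :: K, .proper σ, θK, n, w⟩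
        ⟨𝓔.πL θK, C, K, .proper σ, 𝓔.πR θK, n + 1, w⟩
  | if_true (θ φ C K σ θK n w) (h : L.evalP φ σ = true) :
      Step 𝓔 ⟨θ, .cond φ C, K, .proper σ, θK, n, w⟩ ⟨θ, C, K, .proper σ, θK, n + 1, w⟩
  | if_false (θ φ C K σ θK n w) (h : L.evalP φ σ = false) :
      Step 𝓔 ⟨θ, .cond φ C, K, .proper σ, θK, n, w⟩ ⟨θ, .skip, K, .proper σ, θK, n + 1, w⟩
  | while_true (θ φ C K σ θK n w) (h : L.evalP φ σ = true) :
      Step 𝓔 ⟨θ, .loop φ C, K, .proper σ, θK, n, w⟩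
        ⟨θ, .seq C (.loop φ C), K, .proper σ, θK, n + 1, w⟩
  | while_false (θ φ C K σ θK n w) (h : L.evalP φ σ = false) :
      Step 𝓔 ⟨θ, .loop φ C, K, .proper σ, θK, n, w⟩ ⟨θ, .skip, K, .proper σ, θK, n + 1, w⟩
  | final (θ σ θK n w) :
      Step 𝓔 ⟨θ, .skip, [], .proper σ, θK, n, w⟩ ⟨θ, .skip, [], .proper σ, θK, n + 1, w⟩

section Semantics

variable {L : ExprLang N} {S : Type*} [MeasurableSpace S]

/-- The reflexive transitive closure of the reduction relation. -/
def Steps (𝓔 : EntropySpace S) : Config L S → Config L S → Prop :=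
  Relation.ReflTransGen (Step 𝓔)

/-- The initial configuration `⟨θ, C, [], σ, θ_K, 0, 1⟩`. -/
def initial (θK : S) (C : Prog L) (σ : ExtState N) (θ : S) : Config L S :=
  ⟨θ, C, [], σ, θK, 0, 1⟩

/-- The run from `σ` with entropy `θ` ends in the proper state `τ`. -/
def TerminatesIn (𝓔 : EntropySpace S) (θK : S) (C : Prog L) (σ : ExtState N) (θ : S)
    (τ : State N) : Prop :=
  ∃ θ' n w, Steps 𝓔 (initial θK C σ θ) ⟨θ', .skip, [], .proper τ, θK, n, w⟩

/-- The run reaches an irreducible configuration. -/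
def GetsStuck (𝓔 : EntropySpace S) (θK : S) (C : Prog L) (σ : ExtState N) (θ : S) : Prop :=
  ∃ κ, Steps 𝓔 (initial θK C σ θ) κ ∧ ¬ ∃ κ', Step 𝓔 κ κ'

open Classical in
/-- The final extended state of the run of `C` from `σ` with entropy `θ`. The parameter `θK` is the
dummy entropy of the empty initial continuation. -/
def finalState (𝓔 : EntropySpace S) (θK : S) (C : Prog L) : ExtState N → S → ExtState N
  | .div, _ => .div
  | σ, θ =>
    if h : ∃ τ, TerminatesIn 𝓔 θK C σ θ τ then .proper h.choose
    else if GetsStuck 𝓔 θK C σ θ then .error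
    else .div

/-- After exactly `n` steps the run is in a non-error configuration of weight `w`. -/
def HasWeightAt (𝓔 : EntropySpace S) (θK : S) (C : Prog L) (σ : ExtState N) (θ : S) (n : ℕ)
    (w : ℝ≥0) : Prop :=
  ∃ θ' C' K τ θK', τ ≠ ExtState.error ∧ Steps 𝓔 (initial θK C σ θ) ⟨θ', C', K, τ, θK', n, w⟩

open Classical in
/-- The score of the run after `n` steps. -/
def scoreAt (𝓔 : EntropySpace S) (θK : S) (C : Prog L) (σ : ExtState N) (θ : S) (n : ℕ) : ℝ≥0 :=
  if h : ∃ w, HasWeightAt 𝓔 θK C σ θ n w then h.choose else 0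

/-- The score of the run: the infimum, which is also the limit, of the scores after `n` steps. -/
def runScore (𝓔 : EntropySpace S) (θK : S) (C : Prog L) : ExtState N → S → ℝ≥0
  | .proper σ, θ => ⨅ n, scoreAt 𝓔 θK C (.proper σ) θ n
  | .error, _ => 0
  | .div, _ => 1

/-- The measure on entropies with density `runScore`. -/
def entropyMeasure (𝓔 : EntropySpace S) (θK : S) (C : Prog L) (σ : ExtState N) : Measure S :=
  𝓔.μ.withDensity fun θ => (runScore 𝓔 θK C σ θ : ℝ≥0∞)

/-- The measure `⟦C⟧_σ` on extended states: the push-forward of the score-weighted measure on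
entropies along the final-state map. -/
def opMeasure (𝓔 : EntropySpace S) (θK : S) (C : Prog L) (σ : ExtState N) :
    Measure (ExtState N) :=
  (entropyMeasure 𝓔 θK C σ).map (finalState 𝓔 θK C σ)

/-- The restriction of `⟦C⟧_σ` to the proper states. -/
def opMeasureProper (𝓔 : EntropySpace S) (θK : S) (C : Prog L) (σ : ExtState N) :
    Measure (State N) :=
  (opMeasure 𝓔 θK C σ).comap ExtState.proper

end Semantics

end PL

end

noncomputable section

namespace PL

section

variable {N : Type*} [DecidableEq N]

/-! ### Measurability on states -/

lemma State.keys_insert (σ : State N) (x : N) (v : ℝ) :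
    (σ.insert x v).keys = insert x σ.keys := by
  ext y
  simp [Finmap.mem_keys, Finmap.mem_insert]

lemma State.val_insert_self (σ : State N) (x : N) (v : ℝ) : State.val (σ.insert x v) x = v := by
  simp [State.val]

lemma State.val_insert_of_ne (σ : State N) {x y : N} (v : ℝ) (h : y ≠ x) :
    State.val (σ.insert x v) y = State.val σ y := by
  simp [State.val, Finmap.lookup_insert_of_ne _ h]

lemma State.edist_insert_le (σ τ : State N) (x : N) (v w : ℝ) :
    edist (σ.insert x v) (τ.insert x w) ≤ edist σ τ + edist v w := by
  change State.dist _ _ ≤ State.dist _ _ + _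
  unfold State.dist
  by_cases h : σ.keys = τ.keys
  · rw [State.keys_insert, State.keys_insert, if_pos (by rw [h]), if_pos h]
    have hvw : ENNReal.ofReal |v - w| = edist v w := by
      rw [edist_dist, Real.dist_eq]
    calc _ ≤ ENNReal.ofReal |State.val (σ.insert x v) x - State.val (τ.insert x w) x| +
          ∑ y ∈ σ.keys.erase x,
            ENNReal.ofReal |State.val (σ.insert x v) y - State.val (τ.insert x w) y| := by
          rw [← Finset.add_sum_erase _ _ (Finset.mem_insert_self x σ.keys),
            Finset.erase_insert_eq_erase]
      _ = edist v w + ∑ y ∈ σ.keys.erase x, ENNReal.ofReal |State.val σ y - State.val τ y| := by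
          rw [State.val_insert_self, State.val_insert_self, hvw]
          congr 1
          refine Finset.sum_congr rfl fun y hy => ?_
          rw [State.val_insert_of_ne _ _ (Finset.ne_of_mem_erase hy),
            State.val_insert_of_ne _ _ (Finset.ne_of_mem_erase hy)]
      _ ≤ _ := by
          rw [add_comm]
          gcongr
          exact Finset.erase_subset _ _
  · simp [h]

lemma State.continuous_insert (x : N) :
    Continuous fun p : State N × ℝ => (p.1.insert x p.2 : State N) := by
  have h : LipschitzWith 2 fun p : State N × ℝ => (p.1.insert x p.2 : State N) := by
    intro p q
    refine (State.edist_insert_le _ _ _ _ _).trans ?_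
    rw [Prod.edist_eq, ENNReal.coe_ofNat, two_mul]
    exact add_le_add (le_max_left _ _) (le_max_right _ _)
  exact h.continuous

lemma State.measurable_insert (x : N) :
    Measurable fun p : State N × ℝ => (p.1.insert x p.2 : State N) :=
  (State.continuous_insert x).measurable

lemma ExtState.isometry_proper : Isometry (ExtState.proper : State N → ExtState N) :=
  fun _ _ => rfl

lemma ExtState.isOpen_range_proper : IsOpen (Set.range (ExtState.proper : State N → ExtState N)) := by
  rw [EMetric.isOpen_iff]
  rintro _ ⟨σ, rfl⟩
  refine ⟨1, one_pos, fun b hb => ?_⟩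
  cases b with
  | proper τ => exact ⟨τ, rfl⟩
  | error => exact absurd (show (⊤ : ℝ≥0∞) < 1 from hb) (by simp)
  | div => exact absurd (show (⊤ : ℝ≥0∞) < 1 from hb) (by simp)

lemma ExtState.measurableEmbedding_proper :
    MeasurableEmbedding (ExtState.proper : State N → ExtState N) :=
  ExtState.isometry_proper.isEmbedding.measurableEmbedding
    ExtState.isOpen_range_proper.measurableSet

/-- The extension of a function on proper states by zero. -/
def ExtState.extend {N : Type*} (f : State N → ℝ≥0∞) : ExtState N → ℝ≥0∞
  | .proper σ => f σ
  | _ => 0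

lemma ExtState.extend_eq_zero {N : Type*} (f : State N → ℝ≥0∞) {a : ExtState N}
    (h : a ∉ Set.range (ExtState.proper : State N → ExtState N)) : ExtState.extend f a = 0 := by
  cases a with
  | proper σ => exact absurd ⟨σ, rfl⟩ h
  | error => rfl
  | div => rfl

lemma ExtState.measurable_extend {f : State N → ℝ≥0∞} (hf : Measurable f) :
    Measurable (ExtState.extend f) := by
  have h : ExtState.extend f = Function.extend ExtState.proper f fun _ => 0 := by
    funext a
    by_cases ha : a ∈ Set.range (ExtState.proper : State N → ExtState N)
    · obtain ⟨σ, rfl⟩ := ha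
      rw [ExtState.measurableEmbedding_proper.injective.extend_apply]
      rfl
    · rw [ExtState.extend_eq_zero f ha, Function.extend_apply' _ _ _ ha]
  rw [h]
  exact ExtState.measurableEmbedding_proper.measurable_extend hf measurable_const

lemma lintegral_comap_proper (ν : Measure (ExtState N)) (f : State N → ℝ≥0∞) :
    ∫⁻ τ, f τ ∂(ν.comap ExtState.proper) = ∫⁻ a, ExtState.extend f a ∂ν := by
  have h := ExtState.measurableEmbedding_proper (N := N)
  calc ∫⁻ τ, f τ ∂(ν.comap ExtState.proper)
      = ∫⁻ a, ExtState.extend f a ∂((ν.comap ExtState.proper).map ExtState.proper) := by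
        rw [h.lintegral_map]
        rfl
    _ = ∫⁻ a in Set.range ExtState.proper, ExtState.extend f a ∂ν := by rw [h.map_comap]
    _ = ∫⁻ a, ExtState.extend f a ∂ν :=
        setLIntegral_eq_of_support_subset fun a ha => by
          by_contra h'
          exact ha (ExtState.extend_eq_zero f h')

/-! ### Continuity of the weakest preexpectation transformer -/

lemma measurable_iSup_fun {α : Type*} [MeasurableSpace α] {f : ℕ → α → ℝ≥0∞}
    (hf : ∀ n, Measurable (f n)) : Measurable (⨆ n, f n) := by
  have h : ⨆ n, f n = fun a => ⨆ n, f n a := funext fun a => iSup_apply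
  rw [h]
  exact .iSup hf

/-- A transformer of expectations that preserves measurability and suprema of increasing sequences
of measurable functions. -/
structure MeasurableContinuous (T : (State N → ℝ≥0∞) → (State N → ℝ≥0∞)) : Prop where
  measurable : ∀ f, Measurable f → Measurable (T f)
  map_iSup : ∀ f : ℕ → State N → ℝ≥0∞, (∀ n, Measurable (f n)) → Monotone f →
    T (⨆ n, f n) = ⨆ n, T (f n)

namespace MeasurableContinuous

variable {T U : (State N → ℝ≥0∞) → (State N → ℝ≥0∞)}

lemma mono (hT : MeasurableContinuous T) {f g : State N → ℝ≥0∞} (hf : Measurable f)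
    (hg : Measurable g) (h : f ≤ g) : T f ≤ T g := by
  let u : ℕ → State N → ℝ≥0∞ := fun n => if n = 0 then f else g
  have hu : Monotone u := by
    refine monotone_nat_of_le_succ fun n => ?_
    by_cases hn : n = 0 <;> simp [u, hn, h]
  have hsup : ⨆ n, u n = g := by
    refine le_antisymm (iSup_le fun n => ?_) (le_iSup_of_le 1 (by simp [u]))
    by_cases hn : n = 0 <;> simp [u, hn, h]
  have := hT.map_iSup u (fun n => by by_cases hn : n = 0 <;> simp [u, hn, hf, hg]) hu
  rw [hsup] at this
  rw [this]
  exact le_iSup_of_le 0 (by simp [u])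

lemma id : MeasurableContinuous (fun f : State N → ℝ≥0∞ => f) :=
  ⟨fun _ hf => hf, fun _ _ _ => rfl⟩

lemma const {g : State N → ℝ≥0∞} (hg : Measurable g) : MeasurableContinuous fun _ => g :=
  ⟨fun _ _ => hg, fun _ _ _ => by rw [iSup_const]⟩

lemma comp (hT : MeasurableContinuous T) (hU : MeasurableContinuous U) :
    MeasurableContinuous fun f => T (U f) where
  measurable f hf := hT.measurable _ (hU.measurable _ hf)
  map_iSup f hf hm := by
    rw [hU.map_iSup f hf hm, hT.map_iSup _ (fun n => hU.measurable _ (hf n))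
      fun i j hij => hU.mono (hf i) (hf j) (hm hij)]

lemma ite {p : State N → Bool} (hp : Measurable p) (hT : MeasurableContinuous T)
    (hU : MeasurableContinuous U) :
    MeasurableContinuous fun f σ => if p σ = true then T f σ else U f σ where
  measurable f hf := Measurable.ite (hp (measurableSet_singleton true)) (hT.measurable f hf)
    (hU.measurable f hf)
  map_iSup f hf hm := by
    funext σ
    rw [hT.map_iSup f hf hm, hU.map_iSup f hf hm]
    by_cases h : p σ = true <;> simp [h, iSup_apply]

lemma mul {c : State N → ℝ≥0∞} (hc : Measurable c) :
    MeasurableContinuous fun f σ => c σ * f σ where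
  measurable f hf := hc.mul hf
  map_iSup f hf hm := by
    funext σ
    simp [iSup_apply, ENNReal.mul_iSup]

lemma iSup {T : ℕ → (State N → ℝ≥0∞) → (State N → ℝ≥0∞)}
    (hT : ∀ n, MeasurableContinuous (T n)) : MeasurableContinuous fun f => ⨆ n, T n f where
  measurable f hf := measurable_iSup_fun fun n => (hT n).measurable f hf
  map_iSup f hf hm := by
    simp_rw [fun n => (hT n).map_iSup f hf hm]
    exact iSup_comm

lemma lintegral_insert (x : N) :
    MeasurableContinuous fun f σ => ∫⁻ v in Set.Icc (0 : ℝ) 1, f (σ.insert x v) where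
  measurable f hf :=
    Measurable.lintegral_prod_right' (f := fun p : State N × ℝ => f (p.1.insert x p.2))
      (hf.comp (State.measurable_insert x))
  map_iSup f hf hm := by
    funext σ
    simp only [iSup_apply]
    refine lintegral_iSup (fun n => (hf n).comp ((State.measurable_insert x).comp
      (measurable_const.prodMk measurable_id))) fun i j hij v => hm hij _

lemma measurable_iterate (hT : MeasurableContinuous T) (n : ℕ) : Measurable (T^[n] 0) := by
  induction n with
  | zero => exact measurable_zero
  | succ n ih => rw [Function.iterate_succ_apply']; exact hT.measurable _ ih

lemma monotone_iterate (hT : MeasurableContinuous T) : Monotone fun n => T^[n] 0 := by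
  refine monotone_nat_of_le_succ fun n => ?_
  induction n with
  | zero => exact zero_le
  | succ n ih =>
    rw [Function.iterate_succ_apply', Function.iterate_succ_apply' T (n + 1)]
    exact hT.mono (hT.measurable_iterate _) (hT.measurable_iterate _) ih

lemma map_iSup_iterate (hT : MeasurableContinuous T) : T (⨆ n, T^[n] 0) = ⨆ n, T^[n] 0 := by
  rw [hT.map_iSup _ hT.measurable_iterate hT.monotone_iterate]
  simp_rw [← Function.iterate_succ_apply' T]
  exact hT.monotone_iterate.iSup_nat_add 1

lemma lfpMeasurable_eq (hT : MeasurableContinuous T) : lfpMeasurable T = ⨆ n, T^[n] 0 := by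
  refine le_antisymm (sInf_le ⟨measurable_iSup_fun hT.measurable_iterate, hT.map_iSup_iterate⟩)
    (le_sInf fun X hX => iSup_le fun n => ?_)
  induction n with
  | zero => exact zero_le
  | succ n ih =>
    rw [Function.iterate_succ_apply', ← hX.2]
    exact hT.mono (hT.measurable_iterate n) hX.1 ih

end MeasurableContinuous

variable {L : ExprLang N}

/-- The characteristic functional of a loop. -/
def loopStep (φ : L.Pred) (T : (State N → ℝ≥0∞) → State N → ℝ≥0∞) (f X : State N → ℝ≥0∞) :
    State N → ℝ≥0∞ := fun σ => if L.evalP φ σ = true then T X σ else f σ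

lemma wp_cond (φ : L.Pred) (C : Prog L) (f : State N → ℝ≥0∞) :
    wp (.cond φ C) f = fun σ => if L.evalP φ σ = true then wp C f σ else f σ := by
  funext σ
  cases h : L.evalP φ σ <;> simp [wp, iverson, h]

lemma wp_observe (φ : L.Pred) (f : State N → ℝ≥0∞) :
    wp (.observe φ) f = fun σ => if L.evalP φ σ = true then f σ else 0 := by
  funext σ
  cases h : L.evalP φ σ <;> simp [wp, iverson, h]

lemma wp_score (E : L.Expr) (f : State N → ℝ≥0∞) :
    wp (.score E) f = fun σ =>
      if L.evalE E σ ∈ Set.Ioc (0 : ℝ) 1 then ENNReal.ofReal (L.evalE E σ) * f σ else 0 := by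
  funext σ
  by_cases h : L.evalE E σ ∈ Set.Ioc (0 : ℝ) 1 <;> simp only [wp, iverson, h] <;> simp

lemma wp_loop_eq_lfp (φ : L.Pred) (C : Prog L) (f : State N → ℝ≥0∞) :
    wp (.loop φ C) f = lfpMeasurable (loopStep φ (wp C) f) := by
  rw [wp]
  congr 1
  funext X σ
  cases h : L.evalP φ σ <;> simp [loopStep, iverson, h]

lemma measurableContinuous_loopStep (φ : L.Pred) {T : (State N → ℝ≥0∞) → State N → ℝ≥0∞}
    (hT : MeasurableContinuous T) {f : State N → ℝ≥0∞} (hf : Measurable f) :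
    MeasurableContinuous (loopStep φ T f) :=
  .ite (L.measurable_evalP φ) hT (.const hf)

lemma measurableContinuous_iterate_loopStep (φ : L.Pred)
    {T : (State N → ℝ≥0∞) → State N → ℝ≥0∞} (hT : MeasurableContinuous T) (n : ℕ) :
    MeasurableContinuous fun f => (loopStep φ T f)^[n] 0 := by
  induction n with
  | zero => exact .const measurable_zero
  | succ n ih =>
    simp_rw [Function.iterate_succ_apply']
    exact .ite (L.measurable_evalP φ) (hT.comp ih) .id

lemma MeasurableContinuous.congr {T U : (State N → ℝ≥0∞) → State N → ℝ≥0∞}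
    (hT : MeasurableContinuous T) (h : ∀ f, Measurable f → U f = T f) :
    MeasurableContinuous U where
  measurable f hf := by rw [h f hf]; exact hT.measurable f hf
  map_iSup f hf hm := by
    rw [h _ (measurable_iSup_fun hf), hT.map_iSup f hf hm]
    exact iSup_congr fun n => (h _ (hf n)).symm

lemma measurableContinuous_wp (C : Prog L) : MeasurableContinuous (wp C) := by
  induction C with
  | skip => exact .id
  | diverge => exact .const measurable_zero
  | assign x E =>
    exact ⟨fun f hf => hf.comp ((State.measurable_insert x).comp
      (measurable_id.prodMk (L.measurable_evalE E))), fun f _ _ => by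
        funext σ; simp [wp, iSup_apply]⟩
  | draw x => exact .lintegral_insert x
  | observe φ =>
    simp_rw [funext (wp_observe φ)]
    exact .ite (L.measurable_evalP φ) .id (.const measurable_zero)
  | score E =>
    refine (MeasurableContinuous.mul (c := fun σ => iverson (L.evalE E σ ∈ Set.Ioc (0 : ℝ) 1) *
      ENNReal.ofReal (L.evalE E σ)) (.mul ?_ (L.measurable_evalE E).ennreal_ofReal))
    exact Measurable.ite (L.measurable_evalE E measurableSet_Ioc) measurable_const measurable_const
  | seq C₁ C₂ h₁ h₂ => exact h₁.comp h₂
  | cond φ C ih =>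
    simp_rw [funext (wp_cond φ C)]
    exact .ite (L.measurable_evalP φ) ih .id
  | loop φ C ih =>
    refine (MeasurableContinuous.iSup (measurableContinuous_iterate_loopStep φ ih)).congr
      fun f hf => ?_
    rw [wp_loop_eq_lfp, (measurableContinuous_loopStep φ ih hf).lfpMeasurable_eq]

lemma measurable_wp (C : Prog L) {f : State N → ℝ≥0∞} (hf : Measurable f) : Measurable (wp C f) :=
  (measurableContinuous_wp C).measurable f hf

lemma wp_loop_eq_iSup (φ : L.Pred) (C : Prog L) {f : State N → ℝ≥0∞} (hf : Measurable f) :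
    wp (.loop φ C) f = ⨆ n, (loopStep φ (wp C) f)^[n] 0 := by
  rw [wp_loop_eq_lfp,
    (measurableContinuous_loopStep φ (measurableContinuous_wp C) hf).lfpMeasurable_eq]

lemma loopStep_wp_loop (φ : L.Pred) (C : Prog L) {f : State N → ℝ≥0∞} (hf : Measurable f) :
    loopStep φ (wp C) f (wp (.loop φ C) f) = wp (.loop φ C) f := by
  rw [wp_loop_eq_iSup φ C hf]
  exact (measurableContinuous_loopStep φ (measurableContinuous_wp C) hf).map_iSup_iterate

end

section

variable {N : Type*} [DecidableEq N] {L : ExprLang N}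

/-! ### Splitting sequential compositions -/

/-- The first non-sequence statement of a program. -/
def seqHead : Prog L → Prog L
  | .seq A _ => seqHead A
  | C => C

/-- What remains of `C; D` after its first non-sequence statement. -/
def seqTail : Prog L → Prog L → Prog L
  | .seq A B, D => .seq (seqTail A B) D
  | _, D => D

/-- The number of constructors of a program. -/
def Prog.size : Prog L → ℕ
  | .seq C D => C.size + D.size + 1
  | .cond _ C => C.size + 1
  | .loop _ C => C.size + 1
  | _ => 1

lemma seqHead_seqTail_of_not_seq {C : Prog L} (h : ∀ A B, C ≠ .seq A B) (D : Prog L) :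
    seqHead C = C ∧ seqTail C D = D := by
  cases C <;> first | exact ⟨rfl, rfl⟩ | exact absurd rfl (h _ _)

lemma splits_seq (C D : Prog L) : Splits (.seq C D) (seqHead C) (seqTail C D) := by
  induction C generalizing D with
  | seq A B hA _ => exact .assoc _ _ _ _ (hA B)
  | _ => exact .base _ _ (by simp)

lemma Splits.eq_seqHead_seqTail {X A B : Prog L} (h : Splits X A B) :
    ∃ C D, X = .seq C D ∧ A = seqHead C ∧ B = seqTail C D := by
  induction h with
  | base C D h =>
    obtain ⟨h₁, h₂⟩ := seqHead_seqTail_of_not_seq h D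
    exact ⟨C, D, rfl, h₁.symm, h₂.symm⟩
  | assoc C D A B _ ih =>
    obtain ⟨C₁, C₂, rfl, rfl, rfl⟩ := ih
    exact ⟨_, D, rfl, rfl, rfl⟩

lemma wp_seqHead_seqTail (C D : Prog L) (f : State N → ℝ≥0∞) :
    wp (seqHead C) (wp (seqTail C D) f) = wp C (wp D f) := by
  induction C generalizing D f with
  | seq A B hA _ => exact hA B (wp D f)
  | _ => rfl

lemma size_seqHead_seqTail (C D : Prog L) :
    (seqHead C).size + (seqTail C D).size + 1 ≤ C.size + D.size + 1 := by
  induction C generalizing D with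
  | seq A B hA _ =>
    have := hA B
    simp only [seqHead, seqTail, Prog.size] at this ⊢
    omega
  | _ => exact le_rfl

lemma Prog.size_pos (C : Prog L) : 0 < C.size := by
  cases C <;> simp [Prog.size]

/-! ### Step-bounded weakest preexpectations -/

open Classical in
/-- The expectation of `f` over the runs of `C` followed by the continuation `K` which end within
`n` steps. -/
def boundedWp (f : State N → ℝ≥0∞) : ℕ → Prog L → List (Prog L) → State N → ℝ≥0∞
  | 0, .skip, [], σ => f σ
  | 0, _, _, _ => 0
  | n + 1, .skip, [], σ => boundedWp f n .skip [] σ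
  | n + 1, .skip, D :: K, σ => boundedWp f n D K σ
  | n + 1, .diverge, K, σ => boundedWp f n .diverge K σ
  | n + 1, .assign x E, K, σ => boundedWp f n .skip K (σ.insert x (L.evalE E σ))
  | n + 1, .draw x, K, σ => ∫⁻ v in Set.Icc (0 : ℝ) 1, boundedWp f n .skip K (σ.insert x v)
  | n + 1, .observe φ, K, σ => if L.evalP φ σ = true then boundedWp f n .skip K σ else 0
  | n + 1, .score E, K, σ => if L.evalE E σ ∈ Set.Ioc (0 : ℝ) 1 then
      ENNReal.ofReal (L.evalE E σ) * boundedWp f n .skip K σ else 0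
  | n + 1, .seq C D, K, σ => boundedWp f n (seqHead C) (seqTail C D :: K) σ
  | n + 1, .cond φ C, K, σ => if L.evalP φ σ = true then boundedWp f n C K σ
      else boundedWp f n .skip K σ
  | n + 1, .loop φ C, K, σ => if L.evalP φ σ = true then boundedWp f n (.seq C (.loop φ C)) K σ
      else boundedWp f n .skip K σ

lemma measurable_boundedWp {f : State N → ℝ≥0∞} (hf : Measurable f) (n : ℕ) (C : Prog L)
    (K : List (Prog L)) : Measurable (boundedWp f n C K) := by
  induction n generalizing C K with
  | zero =>
    cases C <;> cases K <;>
      first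
      | exact hf
      | exact measurable_zero
  | succ n ih =>
    cases C with
    | skip => cases K <;> exact ih _ _
    | diverge => exact ih _ _
    | assign x E => exact measurable_wp (.assign x E) (ih .skip K)
    | draw x => exact measurable_wp (L := L) (.draw x) (ih .skip K)
    | observe φ =>
      have := measurable_wp (.observe φ) (ih .skip K)
      rwa [wp_observe] at this
    | score E =>
      have := measurable_wp (.score E) (ih .skip K)
      rwa [wp_score] at this
    | seq C D => exact ih _ _
    | cond φ C =>
      exact Measurable.ite (L.measurable_evalP φ (measurableSet_singleton true)) (ih _ _) (ih _ _)
    | loop φ C =>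
      exact Measurable.ite (L.measurable_evalP φ (measurableSet_singleton true)) (ih _ _) (ih _ _)

lemma boundedWp_le_succ (f : State N → ℝ≥0∞) (n : ℕ) (C : Prog L) (K : List (Prog L)) :
    boundedWp f n C K ≤ boundedWp f (n + 1) C K := by
  induction n generalizing C K with
  | zero =>
    intro σ
    cases C <;> cases K <;> first | exact le_rfl | exact zero_le
  | succ n ih =>
    intro σ
    cases C with
    | skip => cases K <;> exact ih _ _ _
    | diverge => exact ih _ _ _
    | assign x E => exact ih _ _ _
    | draw x => exact lintegral_mono fun v => ih _ _ _
    | observe φ =>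
      rw [boundedWp, boundedWp]
      split_ifs
      exacts [ih _ _ _, le_rfl]
    | score E =>
      rw [boundedWp, boundedWp]
      split_ifs
      exacts [mul_le_mul_right (ih _ _ _) _, le_rfl]
    | seq C D => exact ih _ _ _
    | cond φ C =>
      rw [boundedWp, boundedWp]
      split_ifs
      exacts [ih _ _ _, ih _ _ _]
    | loop φ C =>
      rw [boundedWp, boundedWp]
      split_ifs
      exacts [ih _ _ _, ih _ _ _]

lemma monotone_boundedWp (f : State N → ℝ≥0∞) (C : Prog L) (K : List (Prog L)) :
    Monotone fun n => boundedWp f n C K :=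
  monotone_nat_of_le_succ fun n => boundedWp_le_succ f n C K

/-- The weakest preexpectation of a continuation. -/
def contWp : List (Prog L) → (State N → ℝ≥0∞) → State N → ℝ≥0∞
  | [], f => f
  | C :: K, f => wp C (contWp K f)

lemma measurable_contWp (K : List (Prog L)) {f : State N → ℝ≥0∞} (hf : Measurable f) :
    Measurable (contWp K f) := by
  induction K with
  | nil => exact hf
  | cons C K ih => exact measurable_wp C ih

lemma boundedWp_le_wp {f : State N → ℝ≥0∞} (hf : Measurable f) (n : ℕ) (C : Prog L)
    (K : List (Prog L)) : boundedWp f n C K ≤ wp C (contWp K f) := by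
  induction n generalizing C K with
  | zero =>
    intro σ
    cases C <;> cases K <;> first | exact le_rfl | exact zero_le
  | succ n ih =>
    intro σ
    cases C with
    | skip => cases K <;> exact ih _ _ _
    | diverge => exact ih _ _ _
    | assign x E => exact ih _ _ _
    | draw x => exact lintegral_mono fun v => ih _ _ _
    | observe φ =>
      rw [boundedWp, wp_observe]
      dsimp only
      split_ifs
      exacts [ih _ _ _, le_rfl]
    | score E =>
      rw [boundedWp, wp_score]
      dsimp only
      split_ifs
      exacts [mul_le_mul_right (ih _ _ _) _, le_rfl]
    | seq C D =>
      refine (ih _ _ _).trans_eq ?_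
      exact congrFun (wp_seqHead_seqTail C D (contWp K f)) σ
    | cond φ C =>
      rw [boundedWp, wp_cond]
      dsimp only
      split_ifs
      exacts [ih _ _ _, ih _ _ _]
    | loop φ C =>
      rw [boundedWp, ← loopStep_wp_loop φ C (measurable_contWp K hf), loopStep]
      split_ifs
      exacts [ih _ _ _, ih _ _ _]

/-- The supremum of the step-bounded weakest preexpectations. -/
def limitWp (f : State N → ℝ≥0∞) (C : Prog L) (K : List (Prog L)) (σ : State N) : ℝ≥0∞ :=
  ⨆ n, boundedWp f n C K σ

lemma iSup_boundedWp_succ (f : State N → ℝ≥0∞) (C : Prog L) (K : List (Prog L)) (σ : State N) :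
    ⨆ n, boundedWp f (n + 1) C K σ = limitWp f C K σ :=
  Monotone.iSup_nat_add (fun _ _ h => monotone_boundedWp f C K h σ) 1

lemma limitWp_skip_cons (f : State N → ℝ≥0∞) (D : Prog L) (K : List (Prog L)) :
    limitWp f .skip (D :: K) = limitWp f D K := by
  funext σ
  rw [← iSup_boundedWp_succ]
  rfl

lemma limitWp_seq (f : State N → ℝ≥0∞) (C D : Prog L) (K : List (Prog L)) :
    limitWp f (.seq C D) K = limitWp f (seqHead C) (seqTail C D :: K) := by
  funext σ
  rw [← iSup_boundedWp_succ]
  rfl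

lemma limitWp_loop (f : State N → ℝ≥0∞) (φ : L.Pred) (C : Prog L) (K : List (Prog L)) :
    limitWp f (.loop φ C) K = fun σ => if L.evalP φ σ = true
      then limitWp f (.seq C (.loop φ C)) K σ else limitWp f .skip K σ := by
  funext σ
  rw [← iSup_boundedWp_succ]
  by_cases h : L.evalP φ σ = true <;> simp [boundedWp, h, limitWp]

lemma limitWp_cond (f : State N → ℝ≥0∞) (φ : L.Pred) (C : Prog L) (K : List (Prog L)) :
    limitWp f (.cond φ C) K = fun σ => if L.evalP φ σ = true
      then limitWp f C K σ else limitWp f .skip K σ := by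
  funext σ
  rw [← iSup_boundedWp_succ]
  by_cases h : L.evalP φ σ = true <;> simp [boundedWp, h, limitWp]

lemma measurable_limitWp {f : State N → ℝ≥0∞} (hf : Measurable f) (C : Prog L)
    (K : List (Prog L)) : Measurable (limitWp f C K) :=
  .iSup fun n => measurable_boundedWp hf n C K

lemma limitWp_draw {f : State N → ℝ≥0∞} (hf : Measurable f) (x : N) (K : List (Prog L)) :
    limitWp f (.draw x) K = wp (L := L) (.draw x) (limitWp f .skip K) := by
  funext σ
  rw [← iSup_boundedWp_succ]
  simp only [boundedWp, wp, limitWp]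
  exact (lintegral_iSup (fun n => (measurable_boundedWp hf n .skip K).comp
    ((State.measurable_insert x).comp (measurable_const.prodMk measurable_id)))
    fun i j hij v => monotone_boundedWp f .skip K hij _).symm

lemma limitWp_assign (f : State N → ℝ≥0∞) (x : N) (E : L.Expr) (K : List (Prog L)) :
    limitWp f (.assign x E) K = wp (.assign x E) (limitWp f .skip K) := by
  funext σ
  rw [← iSup_boundedWp_succ]
  rfl

lemma limitWp_observe (f : State N → ℝ≥0∞) (φ : L.Pred) (K : List (Prog L)) :
    limitWp f (.observe φ) K = wp (.observe φ) (limitWp f .skip K) := by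
  funext σ
  rw [← iSup_boundedWp_succ, wp_observe]
  by_cases h : L.evalP φ σ = true <;> simp [boundedWp, h, limitWp]

lemma limitWp_score (f : State N → ℝ≥0∞) (E : L.Expr) (K : List (Prog L)) :
    limitWp f (.score E) K = wp (.score E) (limitWp f .skip K) := by
  funext σ
  rw [← iSup_boundedWp_succ, wp_score]
  by_cases h : L.evalE E σ ∈ Set.Ioc (0 : ℝ) 1
  · simp only [boundedWp, h, limitWp, if_true, ENNReal.mul_iSup]
  · simp only [boundedWp, h, if_false, iSup_const]

/-- Lower bounds for the continuation propagate backwards through a program, both when the program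
is the current statement and when it is the first part of a sequential composition. -/
lemma wp_le_limitWp {f : State N → ℝ≥0∞} (hf : Measurable f) (C : Prog L) :
    (∀ K h, Measurable h → h ≤ limitWp f .skip K → wp C h ≤ limitWp f C K) ∧
    (∀ D K h, Measurable h → h ≤ limitWp f D K → wp C h ≤ limitWp f (.seq C D) K) := by
  induction hs : C.size using Nat.strong_induction_on generalizing C with
  | _ s ih =>
    subst hs
    have mono : ∀ (C : Prog L) (K : List (Prog L)) (h : State N → ℝ≥0∞), Measurable h →
        h ≤ limitWp f .skip K → wp C h ≤ wp C (limitWp f .skip K) := fun C K h hh hle =>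
      (measurableContinuous_wp C).mono hh (measurable_limitWp hf _ _) hle
    have stmt : ∀ K h, Measurable h → h ≤ limitWp f .skip K → wp C h ≤ limitWp f C K := by
      intro K h hh hle
      cases C with
      | skip => exact hle
      | diverge => exact fun σ => zero_le
      | assign x E => rw [limitWp_assign]; exact mono _ _ _ hh hle
      | draw x => rw [limitWp_draw hf]; exact mono _ _ _ hh hle
      | observe φ => rw [limitWp_observe]; exact mono _ _ _ hh hle
      | score E => rw [limitWp_score]; exact mono _ _ _ hh hle
      | seq C D =>
        have hC := (ih C.size (by simp only [Prog.size]; omega) C rfl).2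
        have hD := (ih D.size (by simp only [Prog.size]; omega) D rfl).1
        exact hC D K _ (measurable_wp D hh) (hD K h hh hle)
      | cond φ C =>
        have hC := (ih C.size (by simp only [Prog.size]; omega) C rfl).1 K h hh hle
        rw [limitWp_cond, wp_cond]
        intro σ
        dsimp only
        split_ifs
        exacts [hC σ, hle σ]
      | loop φ C =>
        have hC := (ih C.size (by simp only [Prog.size]; omega) C rfl).2
        have hcont := measurableContinuous_loopStep φ (measurableContinuous_wp C) hh
        rw [wp_loop_eq_iSup φ C hh]
        refine iSup_le fun n => ?_
        induction n with
        | zero => exact fun σ => zero_le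
        | succ n ihn =>
          have := hC (.loop φ C) K _ (hcont.measurable_iterate n) ihn
          rw [Function.iterate_succ_apply', limitWp_loop]
          intro σ
          dsimp only [loopStep]
          split_ifs
          exacts [this σ, hle σ]
    refine ⟨stmt, fun D K h hh hle => ?_⟩
    rw [limitWp_seq]
    by_cases hC : ∃ A B, C = .seq A B
    · obtain ⟨A, B, rfl⟩ := hC
      have hsize := size_seqHead_seqTail A B
      have hhead := (ih _ (by
        have := (seqTail A B).size_pos
        simp only [Prog.size]; omega) (seqHead A) rfl).1
      have htail := (ih _ (by
        have := (seqHead A).size_pos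
        simp only [Prog.size]; omega) (seqTail A B) rfl).2 D K h hh hle
      change wp A (wp B h) ≤ limitWp f (seqHead A) (.seq (seqTail A B) D :: K)
      rw [← wp_seqHead_seqTail]
      exact hhead _ _ (measurable_wp _ hh) (by rwa [limitWp_skip_cons])
    · obtain ⟨h₁, h₂⟩ := seqHead_seqTail_of_not_seq (fun A B h => hC ⟨A, B, h⟩) D
      rw [h₁, h₂]
      exact stmt _ _ hh (by rwa [limitWp_skip_cons])

lemma iSup_boundedWp {f : State N → ℝ≥0∞} (hf : Measurable f) (C : Prog L) (σ : State N) :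
    ⨆ n, boundedWp f n C [] σ = wp C f σ := by
  refine le_antisymm (iSup_le fun n => boundedWp_le_wp hf n C [] σ) ?_
  exact (wp_le_limitWp hf C).1 [] f hf (fun τ => le_iSup_of_le 0 le_rfl) σ

end

section

variable {N : Type*} [DecidableEq N] {L : ExprLang N} {S : Type*} [MeasurableSpace S]

/-! ### The reduction relation as a function -/

/-- The error configuration entered by failing and by stuck configurations, with weight zero. -/
def failed (L : ExprLang N) (θ θK : S) (n : ℕ) : Config L S :=
  ⟨θ, .skip, [], .error, θK, n, 0⟩

open Classical in
/-- One step from a configuration with a proper state. -/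
def advanceProper (𝓔 : EntropySpace S) (θ : S) :
    Prog L → List (Prog L) → State N → S → ℕ → ℝ≥0 → Config L S
  | .skip, [], σ, θK, n, w => ⟨θ, .skip, [], .proper σ, θK, n + 1, w⟩
  | .skip, D :: K, σ, θK, n, w => ⟨𝓔.πL θK, D, K, .proper σ, 𝓔.πR θK, n + 1, w⟩
  | .diverge, K, σ, θK, n, w => ⟨θ, .diverge, K, .proper σ, θK, n + 1, w⟩
  | .assign x E, K, σ, θK, n, w =>
      ⟨θ, .skip, K, .proper (σ.insert x (L.evalE E σ)), θK, n + 1, w⟩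
  | .draw x, K, σ, θK, n, w =>
      ⟨𝓔.πR θ, .skip, K, .proper (σ.insert x (𝓔.πU (𝓔.πL θ) : ℝ)), θK, n + 1, w⟩
  | .observe φ, K, σ, θK, n, w =>
      if L.evalP φ σ = true then ⟨θ, .skip, K, .proper σ, θK, n + 1, w⟩
      else failed L θ θK (n + 1)
  | .score E, K, σ, θK, n, w =>
      if L.evalE E σ ∈ Set.Ioc (0 : ℝ) 1 then
        ⟨θ, .skip, K, .proper σ, θK, n + 1, w * (L.evalE E σ).toNNReal⟩
      else failed L θ θK (n + 1)
  | .seq C D, K, σ, θK, n, w =>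
      ⟨𝓔.πL θ, seqHead C, seqTail C D :: K, .proper σ, 𝓔.pair (𝓔.πR θ) θK, n + 1, w⟩
  | .cond φ C, K, σ, θK, n, w =>
      if L.evalP φ σ = true then ⟨θ, C, K, .proper σ, θK, n + 1, w⟩
      else ⟨θ, .skip, K, .proper σ, θK, n + 1, w⟩
  | .loop φ C, K, σ, θK, n, w =>
      if L.evalP φ σ = true then ⟨θ, .seq C (.loop φ C), K, .proper σ, θK, n + 1, w⟩
      else ⟨θ, .skip, K, .proper σ, θK, n + 1, w⟩

/-- The reduction relation, made total by sending irreducible configurations to the error state. -/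
def advance (𝓔 : EntropySpace S) : Config L S → Config L S
  | ⟨θ, C, K, .proper σ, θK, n, w⟩ => advanceProper 𝓔 θ C K σ θK n w
  | ⟨θ, _, _, _, θK, n, _⟩ => failed L θ θK (n + 1)

variable (𝓔 : EntropySpace S)

lemma steps_advance (κ : Config L S) : (advance 𝓔 κ).steps = κ.steps + 1 := by
  obtain ⟨θ, C, K, s, θK, n, w⟩ := κ
  cases s with
  | proper σ =>
    cases C <;> cases K <;> simp only [advance, advanceProper] <;> (try split_ifs) <;> rfl
  | _ => rfl

lemma advance_of_not_proper {κ : Config L S} (h : ∀ σ, κ.state ≠ .proper σ) :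
    (advance 𝓔 κ).state = .error := by
  obtain ⟨θ, C, K, s, θK, n, w⟩ := κ
  cases s with
  | proper σ => exact absurd rfl (h σ)
  | _ => rfl

lemma weight_advance_of_error {κ : Config L S} (h : (advance 𝓔 κ).state = .error) :
    (advance 𝓔 κ).weight = 0 := by
  obtain ⟨θ, C, K, s, θK, n, w⟩ := κ
  cases s with
  | proper σ =>
    revert h
    cases C <;> cases K <;> simp only [advance, advanceProper] <;> (try split_ifs) <;> simp [failed]
  | _ => rfl

lemma weight_advance_le (κ : Config L S) : (advance 𝓔 κ).weight ≤ κ.weight := by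
  obtain ⟨θ, C, K, s, θK, n, w⟩ := κ
  cases s with
  | proper σ =>
    cases C with
    | score E =>
      simp only [advance, advanceProper]
      split_ifs with h
      · exact mul_le_of_le_one_right' (Real.toNNReal_le_one.mpr h.2)
      · exact zero_le
    | _ =>
      cases K <;> simp only [advance, advanceProper] <;> (try split_ifs) <;> simp [failed]
  | _ => exact zero_le

lemma Step.proper_left {κ κ' : Config L S} (h : Step 𝓔 κ κ') : ∃ σ, κ.state = .proper σ := by
  cases h <;> exact ⟨_, rfl⟩

lemma Step.eq_advance {κ κ' : Config L S} (h : Step 𝓔 κ κ') :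
    κ' = advance 𝓔 κ ∨
      (κ'.state = .error ∧ (advance 𝓔 κ).state = .error ∧ κ'.steps = κ.steps + 1) := by
  cases h with
  | condition_false θ φ K σ θK n w h => right; simp [advance, advanceProper, h, failed]
  | seq θ C C₁ C₂ K σ θK n w h =>
    obtain ⟨A, B, rfl, rfl, rfl⟩ := h.eq_seqHead_seqTail
    exact Or.inl rfl
  | score θ E K σ θK n w h => left; rw [advance, advanceProper, if_pos h]
  | _ => left; simp [advance, advanceProper, *]

lemma step_advance {κ : Config L S} (h : (advance 𝓔 κ).state ≠ .error) :
    Step 𝓔 κ (advance 𝓔 κ) := by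
  obtain ⟨θ, C, K, s, θK, n, w⟩ := κ
  cases s with
  | proper σ =>
    revert h
    cases C with
    | skip =>
      cases K with
      | nil => exact fun _ => .final ..
      | cons D K => exact fun _ => .pop ..
    | diverge => exact fun _ => .diverge ..
    | assign x E => exact fun _ => .assign ..
    | draw x => exact fun _ => .draw ..
    | observe φ =>
      simp only [advance, advanceProper]
      split_ifs with hφ
      · exact fun _ => .condition_true _ _ _ _ _ _ _ hφ
      · exact fun h => absurd rfl h
    | score E =>
      simp only [advance, advanceProper]
      split_ifs with hE
      · exact fun _ => .score _ _ _ _ _ _ _ hE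
      · exact fun h => absurd rfl h
    | seq C D => exact fun _ => .seq _ _ _ _ _ _ _ _ _ (splits_seq C D)
    | cond φ C =>
      simp only [advance, advanceProper]
      split_ifs with hφ
      · exact fun _ => .if_true _ _ _ _ _ _ _ _ hφ
      · exact fun _ => .if_false _ _ _ _ _ _ _ _ (by simpa using hφ)
    | loop φ C =>
      simp only [advance, advanceProper]
      split_ifs with hφ
      · exact fun _ => .while_true _ _ _ _ _ _ _ _ hφ
      · exact fun _ => .while_false _ _ _ _ _ _ _ _ (by simpa using hφ)
  | _ => exact absurd rfl h

/-! ### Runs -/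

variable {𝓔} in
lemma Steps.eq_iterate {κ₀ κ : Config L S} (h₀ : κ₀.steps = 0) (h : Steps 𝓔 κ₀ κ) :
    κ = (advance 𝓔)^[κ.steps] κ₀ ∨
      (κ.state = .error ∧ ((advance 𝓔)^[κ.steps] κ₀).state = .error) := by
  induction h with
  | refl => left; rw [h₀]; rfl
  | @tail κ₁ κ₂ _ hs ih =>
    have heq : κ₁ = (advance 𝓔)^[κ₁.steps] κ₀ := by
      obtain ⟨σ, hσ⟩ := hs.proper_left
      exact ih.resolve_right fun h => by simp [hσ] at h
    rcases hs.eq_advance with h | ⟨h₁, h₂, h₃⟩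
    · left
      have hn : κ₂.steps = κ₁.steps + 1 := by rw [h, steps_advance]
      rw [hn, Function.iterate_succ_apply', ← heq, h]
    · right
      rw [h₃, Function.iterate_succ_apply', ← heq]
      exact ⟨h₁, h₂⟩

lemma steps_iterate {κ₀ : Config L S} {n : ℕ} (h : ((advance 𝓔)^[n] κ₀).state ≠ .error) :
    Steps 𝓔 κ₀ ((advance 𝓔)^[n] κ₀) := by
  induction n with
  | zero => exact .refl
  | succ n ih =>
    rw [Function.iterate_succ_apply'] at h ⊢
    refine .tail (ih fun h' => h (advance_of_not_proper 𝓔 fun σ => ?_)) (step_advance 𝓔 h)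
    simp [h']

lemma iterate_steps (κ₀ : Config L S) (n : ℕ) :
    ((advance 𝓔)^[n] κ₀).steps = κ₀.steps + n := by
  induction n with
  | zero => rfl
  | succ n ih => rw [Function.iterate_succ_apply', steps_advance, ih, add_assoc]

/-- The state of a configuration seen from outside: the state of a final configuration, the error
state, or `div` while the run goes on. -/
def Config.outcome {S : Type*} : Config L S → ExtState N
  | ⟨_, .skip, [], .proper σ, _, _, _⟩ => .proper σ
  | ⟨_, _, _, .error, _, _, _⟩ => .error
  | _ => .div

lemma Config.outcome_eq_proper {S : Type*} {κ : Config L S} {τ : State N} (h : κ.outcome = .proper τ) :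
    κ.stmt = .skip ∧ κ.cont = [] ∧ κ.state = .proper τ := by
  obtain ⟨θ, C, K, s, θK, n, w⟩ := κ
  cases s <;> cases C <;> cases K <;> simp_all [Config.outcome]

lemma Config.outcome_eq_error {S : Type*} {κ : Config L S} : κ.outcome = .error ↔ κ.state = .error := by
  obtain ⟨θ, C, K, s, θK, n, w⟩ := κ
  cases s <;> cases C <;> cases K <;> simp [Config.outcome]

lemma advance_of_outcome_proper {κ : Config L S} {τ : State N} (h : κ.outcome = .proper τ) :
    (advance 𝓔 κ).outcome = .proper τ ∧ (advance 𝓔 κ).weight = κ.weight := by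
  obtain ⟨h₁, h₂, h₃⟩ := Config.outcome_eq_proper h
  obtain ⟨θ, C, K, s, θK, n, w⟩ := κ
  subst h₁ h₂ h₃
  exact ⟨rfl, rfl⟩

lemma advance_of_outcome_error {κ : Config L S} (h : κ.outcome = .error) :
    (advance 𝓔 κ).outcome = .error := by
  rw [Config.outcome_eq_error] at h ⊢
  exact advance_of_not_proper 𝓔 fun σ => by simp [h]

lemma outcome_advance {κ : Config L S} (h : κ.outcome ≠ .div) :
    (advance 𝓔 κ).outcome = κ.outcome := by
  cases h' : κ.outcome with
  | proper τ => exact (advance_of_outcome_proper 𝓔 h').1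
  | error => exact advance_of_outcome_error 𝓔 h'
  | div => exact absurd h' h

lemma outcome_iterate_of_le {κ : Config L S} {m n : ℕ} (hmn : m ≤ n)
    (h : ((advance 𝓔)^[m] κ).outcome ≠ .div) :
    ((advance 𝓔)^[n] κ).outcome = ((advance 𝓔)^[m] κ).outcome := by
  induction n, hmn using Nat.le_induction with
  | base => rfl
  | succ n _ ih =>
    rw [Function.iterate_succ_apply', outcome_advance 𝓔 (by rwa [ih]), ih]

lemma weight_iterate_of_le {κ : Config L S} {m n : ℕ} (hmn : m ≤ n) {τ : State N}
    (h : ((advance 𝓔)^[m] κ).outcome = .proper τ) :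
    ((advance 𝓔)^[n] κ).weight = ((advance 𝓔)^[m] κ).weight := by
  induction n, hmn using Nat.le_induction with
  | base => rfl
  | succ n hn ih =>
    rw [Function.iterate_succ_apply', (advance_of_outcome_proper 𝓔 (τ := τ) _).2, ih]
    rw [outcome_iterate_of_le 𝓔 hn (by simp [h]), h]

lemma antitone_weight_iterate (κ : Config L S) : Antitone fun n => ((advance 𝓔)^[n] κ).weight :=
  antitone_nat_of_succ_le fun n => by
    rw [Function.iterate_succ_apply']
    exact weight_advance_le 𝓔 _

/-- The bottom of the stack of continuation entropies never changes. -/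
lemma bottom_advance {κ : Config L S} (h : (advance 𝓔 κ).state ≠ .error) :
    𝓔.πR^[(advance 𝓔 κ).cont.length] (advance 𝓔 κ).contEntropy =
      𝓔.πR^[κ.cont.length] κ.contEntropy := by
  revert h
  obtain ⟨θ, C, K, s, θK, n, w⟩ := κ
  cases s with
  | proper σ =>
    cases C <;> cases K <;> simp only [advance, advanceProper] <;> (try split_ifs) <;>
      simp [failed, 𝓔.πR_pair]
  | _ => exact fun h => absurd rfl h

lemma bottom_iterate {κ : Config L S} {n : ℕ} (h : ((advance 𝓔)^[n] κ).state ≠ .error) :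
    𝓔.πR^[((advance 𝓔)^[n] κ).cont.length] ((advance 𝓔)^[n] κ).contEntropy =
      𝓔.πR^[κ.cont.length] κ.contEntropy := by
  induction n with
  | zero => rfl
  | succ n ih =>
    rw [Function.iterate_succ_apply'] at h ⊢
    rw [bottom_advance 𝓔 h, ih fun h' => h (advance_of_not_proper 𝓔 fun σ => by simp [h'])]

lemma terminatesIn_iff (θK : S) (C : Prog L) (σ : State N) (θ : S) (τ : State N) :
    TerminatesIn 𝓔 θK C (.proper σ) θ τ ↔
      ∃ n, ((advance 𝓔)^[n] (initial θK C (.proper σ) θ)).outcome = .proper τ := by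
  constructor
  · rintro ⟨θ', n, w, h⟩
    refine ⟨n, ?_⟩
    rcases h.eq_iterate rfl with h | h
    · rw [← h]; rfl
    · exact absurd h.1 (by simp)
  · rintro ⟨n, h⟩
    obtain ⟨h₁, h₂, h₃⟩ := Config.outcome_eq_proper h
    have herr : ((advance 𝓔)^[n] (initial θK C (.proper σ) θ)).state ≠ .error := by simp [h₃]
    have hb := bottom_iterate 𝓔 herr
    have hs := steps_iterate 𝓔 herr
    generalize (advance 𝓔)^[n] (initial θK C (.proper σ) θ) = κ at *
    obtain ⟨θ', C', K, s, θK', m, w⟩ := κ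
    dsimp only at h₁ h₂ h₃
    subst h₁ h₂ h₃
    obtain rfl : θK' = θK := hb
    exact ⟨θ', m, w, hs⟩

lemma getsStuck_iff (θK : S) (C : Prog L) (σ : State N) (θ : S) :
    GetsStuck 𝓔 θK C (.proper σ) θ ↔
      ∃ n, ((advance 𝓔)^[n] (initial θK C (.proper σ) θ)).outcome = .error := by
  simp_rw [Config.outcome_eq_error]
  constructor
  · rintro ⟨κ, hκ, hstuck⟩
    rcases hκ.eq_iterate rfl with h | h
    · refine ⟨κ.steps + 1, ?_⟩
      rw [Function.iterate_succ_apply', ← h]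
      by_contra h'
      exact hstuck ⟨_, step_advance 𝓔 h'⟩
    · exact ⟨_, h.2⟩
  · intro h
    classical
    have hspec := Nat.find_spec h
    cases hn : Nat.find h with
    | zero => rw [hn] at hspec; exact absurd hspec (by simp [initial])
    | succ n =>
      rw [hn, Function.iterate_succ_apply'] at hspec
      have hreach := steps_iterate 𝓔 (Nat.find_min h (m := n) (by omega))
      by_cases hstep : ∃ κ', Step 𝓔 ((advance 𝓔)^[n] (initial θK C (.proper σ) θ)) κ'
      · obtain ⟨κ', hκ'⟩ := hstep
        refine ⟨κ', hreach.tail hκ', fun ⟨κ'', h''⟩ => ?_⟩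
        obtain ⟨ρ, hρ⟩ := h''.proper_left
        have herr : κ'.state = .error := by
          rcases hκ'.eq_advance with h | h
          · rw [h, hspec]
          · exact h.1
        simp [hρ] at herr
      · exact ⟨_, hreach, hstep⟩

/-- Once the outcome of a run is settled, it is its final state. -/
lemma finalState_of_outcome {θK : S} {C : Prog L} {σ : State N} {θ : S} {n : ℕ}
    (h : ((advance 𝓔)^[n] (initial θK C (.proper σ) θ)).outcome ≠ .div) :
    finalState 𝓔 θK C (.proper σ) θ =
      ((advance 𝓔)^[n] (initial θK C (.proper σ) θ)).outcome := by
  have huniq : ∀ m a, ((advance 𝓔)^[m] (initial θK C (.proper σ) θ)).outcome = a → a ≠ .div →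
      ((advance 𝓔)^[n] (initial θK C (.proper σ) θ)).outcome = a := by
    intro m a hm ha
    rcases le_total m n with hmn | hmn
    · rw [outcome_iterate_of_le 𝓔 hmn (by rwa [hm]), hm]
    · rw [← hm, outcome_iterate_of_le 𝓔 hmn h]
  rw [finalState]
  split_ifs with h₁ h₂
  · obtain ⟨m, hm⟩ := (terminatesIn_iff 𝓔 _ _ _ _ _).1 h₁.choose_spec
    exact (huniq m _ hm (by simp)).symm
  · obtain ⟨m, hm⟩ := (getsStuck_iff 𝓔 _ _ _ _).1 h₂
    exact (huniq m _ hm (by simp)).symm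
  · cases h' : ((advance 𝓔)^[n] (initial θK C (.proper σ) θ)).outcome with
    | proper τ => exact absurd ⟨τ, (terminatesIn_iff 𝓔 _ _ _ _ _).2 ⟨n, h'⟩⟩ h₁
    | error => exact absurd ((getsStuck_iff 𝓔 _ _ _ _).2 ⟨n, h'⟩) h₂
    | div => exact absurd h' h
  · simp

lemma finalState_of_forall_outcome {θK : S} {C : Prog L} {σ : State N} {θ : S}
    (h : ∀ n, ((advance 𝓔)^[n] (initial θK C (.proper σ) θ)).outcome = .div) :
    finalState 𝓔 θK C (.proper σ) θ = .div := by
  rw [finalState]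
  · rw [dif_neg, if_neg]
    · rw [getsStuck_iff]
      simp [h]
    · simp_rw [terminatesIn_iff]
      simp [h]
  · simp

lemma scoreAt_eq (θK : S) (C : Prog L) (σ : State N) (θ : S) (n : ℕ) :
    scoreAt 𝓔 θK C (.proper σ) θ n =
      ((advance 𝓔)^[n] (initial θK C (.proper σ) θ)).weight := by
  have hw : ∀ w, HasWeightAt 𝓔 θK C (.proper σ) θ n w →
      w = ((advance 𝓔)^[n] (initial θK C (.proper σ) θ)).weight := by
    rintro w ⟨θ', C', K, τ, θK', hτ, h⟩
    rcases h.eq_iterate rfl with h | h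
    · rw [← h]
    · exact absurd h.1 hτ
  rw [scoreAt]
  split_ifs with h
  · exact hw _ h.choose_spec
  · by_cases herr : ((advance 𝓔)^[n] (initial θK C (.proper σ) θ)).state = .error
    · cases n with
      | zero => exact absurd herr (by simp [initial])
      | succ n =>
        rw [Function.iterate_succ_apply'] at herr ⊢
        exact (weight_advance_of_error 𝓔 herr).symm
    · refine absurd ?_ h
      have hs := steps_iterate 𝓔 herr
      have hn := iterate_steps 𝓔 (initial θK C (.proper σ) θ) n
      have h0 : (initial θK C (.proper σ) θ : Config L S).steps = 0 := rfl
      rw [h0, zero_add] at hn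
      generalize (advance 𝓔)^[n] (initial θK C (.proper σ) θ) = κ at *
      obtain ⟨θ', C', K, s, θK', m, w⟩ := κ
      obtain rfl : m = n := hn
      exact ⟨w, θ', C', K, s, θK', herr, hs⟩

lemma runScore_eq (θK : S) (C : Prog L) (σ : State N) (θ : S) :
    runScore 𝓔 θK C (.proper σ) θ =
      ⨅ n, ((advance 𝓔)^[n] (initial θK C (.proper σ) θ)).weight := by
  simp only [runScore, scoreAt_eq]

lemma runScore_of_outcome_proper {θK : S} {C : Prog L} {σ τ : State N} {θ : S} {n : ℕ}
    (h : ((advance 𝓔)^[n] (initial θK C (.proper σ) θ)).outcome = .proper τ) :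
    runScore 𝓔 θK C (.proper σ) θ =
      ((advance 𝓔)^[n] (initial θK C (.proper σ) θ)).weight := by
  rw [runScore_eq]
  refine le_antisymm (ciInf_le (OrderBot.bddBelow _) n) (le_ciInf fun m => ?_)
  rcases le_total m n with hmn | hmn
  · exact antitone_weight_iterate 𝓔 _ hmn
  · exact (weight_iterate_of_le 𝓔 hmn h).ge

end

section

variable {N : Type*} [DecidableEq N] {L : ExprLang N} {S : Type*} [MeasurableSpace S]

/-! ### Measurability of runs -/

/-- A function on configurations that is measurable for each fixed statement, continuation and step
count. -/
structure SliceMeasurable {β : Type*} [MeasurableSpace β] (q : Config L S → β) : Prop where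
  proper : ∀ C K n, Measurable fun p : (State N × S) × (S × ℝ≥0) =>
    q ⟨p.1.2, C, K, .proper p.1.1, p.2.1, n, p.2.2⟩
  failed : ∀ n, Measurable fun p : S × S => q (failed L p.1 p.2 n)

namespace SliceMeasurable

variable {β : Type*} [MeasurableSpace β] {q : Config L S → β}

lemma comp_proper (hq : SliceMeasurable q) (C : Prog L) (K : List (Prog L)) (n : ℕ)
    {α : Type*} [MeasurableSpace α] {s : α → State N} {θ θK : α → S} {w : α → ℝ≥0}
    (hs : Measurable s) (hθ : Measurable θ) (hθK : Measurable θK) (hw : Measurable w) :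
    Measurable fun a => q ⟨θ a, C, K, .proper (s a), θK a, n, w a⟩ :=
  (hq.proper C K n).comp ((hs.prodMk hθ).prodMk (hθK.prodMk hw))

lemma comp_failed (hq : SliceMeasurable q) (n : ℕ) {α : Type*} [MeasurableSpace α]
    {θ θK : α → S} (hθ : Measurable θ) (hθK : Measurable θK) :
    Measurable fun a => q (PL.failed L (θ a) (θK a) n) :=
  (hq.failed n).comp (hθ.prodMk hθK)

lemma advance (𝓔 : EntropySpace S) (hq : SliceMeasurable q) :
    SliceMeasurable fun κ => q (advance 𝓔 κ) where
  failed n := hq.failed (n + 1)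
  proper C K n := by
    have hL := 𝓔.measurable_πL
    have hR := 𝓔.measurable_πR
    have hs : Measurable fun p : (State N × S) × (S × ℝ≥0) => p.1.1 := by fun_prop
    have hθ : Measurable fun p : (State N × S) × (S × ℝ≥0) => p.1.2 := by fun_prop
    have hθK : Measurable fun p : (State N × S) × (S × ℝ≥0) => p.2.1 := by fun_prop
    have hw : Measurable fun p : (State N × S) × (S × ℝ≥0) => p.2.2 := by fun_prop
    have hp : ∀ φ : L.Pred, MeasurableSet
        {p : (State N × S) × (S × ℝ≥0) | L.evalP φ p.1.1 = true} := fun φ =>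
      ((L.measurable_evalP φ).comp hs) (measurableSet_singleton true)
    cases C with
    | skip =>
      cases K with
      | nil => exact hq.comp_proper _ _ _ hs hθ hθK hw
      | cons D K => exact hq.comp_proper _ _ _ hs (hL.comp hθK) (hR.comp hθK) hw
    | diverge => exact hq.comp_proper _ _ _ hs hθ hθK hw
    | assign x E =>
      exact hq.comp_proper _ _ _ ((State.measurable_insert x).comp
        (hs.prodMk ((L.measurable_evalE E).comp hs))) hθ hθK hw
    | draw x =>
      exact hq.comp_proper _ _ _ ((State.measurable_insert x).comp (hs.prodMk
        (measurable_subtype_coe.comp (𝓔.measurable_πU.comp (hL.comp hθ))))) (hR.comp hθ) hθK hw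
    | observe φ =>
      simp only [PL.advance, advanceProper, apply_ite q]
      exact Measurable.ite (hp φ) (hq.comp_proper _ _ _ hs hθ hθK hw) (hq.comp_failed _ hθ hθK)
    | score E =>
      have hE := (L.measurable_evalE E).comp hs
      simp only [PL.advance, advanceProper, apply_ite q]
      exact Measurable.ite (hE measurableSet_Ioc)
        (hq.comp_proper _ _ _ hs hθ hθK (hw.mul hE.real_toNNReal)) (hq.comp_failed _ hθ hθK)
    | seq C D =>
      exact hq.comp_proper _ _ _ hs (hL.comp hθ)
        (𝓔.measurable_pair.comp ((hR.comp hθ).prodMk hθK)) hw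
    | cond φ C =>
      simp only [PL.advance, advanceProper, apply_ite q]
      exact Measurable.ite (hp φ) (hq.comp_proper _ _ _ hs hθ hθK hw)
        (hq.comp_proper _ _ _ hs hθ hθK hw)
    | loop φ C =>
      simp only [PL.advance, advanceProper, apply_ite q]
      exact Measurable.ite (hp φ) (hq.comp_proper _ _ _ hs hθ hθK hw)
        (hq.comp_proper _ _ _ hs hθ hθK hw)

lemma iterate (𝓔 : EntropySpace S) (hq : SliceMeasurable q) (n : ℕ) :
    SliceMeasurable fun κ => q ((PL.advance 𝓔)^[n] κ) := by
  induction n with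
  | zero => exact hq
  | succ n ih => exact ih.advance 𝓔

lemma weight : SliceMeasurable (fun κ : Config L S => κ.weight) :=
  ⟨fun _ _ _ => measurable_snd.snd, fun _ => measurable_const⟩

lemma outcome : SliceMeasurable (fun κ : Config L S => κ.outcome) where
  failed _ := measurable_const
  proper C K n := by
    cases C <;> cases K <;>
      first
      | exact ExtState.measurableEmbedding_proper.measurable.comp measurable_fst.fst
      | exact measurable_const

lemma measurable_initial (hq : SliceMeasurable q) (θK : S) (C : Prog L) (σ : State N) :
    Measurable fun θ => q (initial θK C (.proper σ) θ) :=
  hq.comp_proper C [] 0 measurable_const measurable_id measurable_const measurable_const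

end SliceMeasurable

variable (𝓔 : EntropySpace S)

lemma measurable_runScore (θK : S) (C : Prog L) (σ : State N) :
    Measurable (runScore 𝓔 θK C (.proper σ)) := by
  simp_rw [funext (runScore_eq 𝓔 θK C σ)]
  exact .iInf fun n => (SliceMeasurable.weight.iterate 𝓔 n).measurable_initial θK C σ

lemma measurable_finalState (θK : S) (C : Prog L) (σ : State N) :
    Measurable (finalState 𝓔 θK C (.proper σ)) := by
  have hout := fun n => (SliceMeasurable.outcome.iterate 𝓔 n).measurable_initial θK C σ
  intro A hA
  have hdiv : MeasurableSet ({.div} : Set (ExtState N)) := measurableSet_singleton _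
  have h : finalState 𝓔 θK C (.proper σ) ⁻¹' A =
      (⋃ n, (fun θ => ((advance 𝓔)^[n] (initial θK C (.proper σ) θ)).outcome) ⁻¹' (A \ {.div})) ∪
      ((⋂ n, (fun θ => ((advance 𝓔)^[n] (initial θK C (.proper σ) θ)).outcome) ⁻¹' {.div}) ∩
        {_θ | ExtState.div ∈ A}) := by
    ext θ
    simp only [Set.mem_preimage, Set.mem_union, Set.mem_iUnion, Set.mem_inter_iff, Set.mem_iInter,
      Set.mem_singleton_iff, Set.mem_sdiff, Set.mem_ofPred_eq]
    by_cases hθ : ∀ n, ((advance 𝓔)^[n] (initial θK C (.proper σ) θ)).outcome = .div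
    · simp [finalState_of_forall_outcome 𝓔 hθ, hθ]
    · obtain ⟨n, hn⟩ := not_forall.1 hθ
      constructor
      · intro h
        exact Or.inl ⟨n, by rwa [← finalState_of_outcome 𝓔 hn], hn⟩
      · rintro (⟨m, hm, hm'⟩ | ⟨h, -⟩)
        · rwa [finalState_of_outcome 𝓔 hm']
        · exact absurd h hθ
  rw [h]
  exact (MeasurableSet.iUnion fun n => hout n (hA.diff hdiv)).union
    ((MeasurableSet.iInter fun n => hout n hdiv).inter (.const _))

/-! ### The law of the entropies -/

lemma EntropySpace.isProbabilityMeasure : IsProbabilityMeasure 𝓔.μ := ⟨𝓔.measure_univ⟩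

lemma EntropySpace.measurePreserving_πU : MeasurePreserving 𝓔.πU 𝓔.μ volume := by
  refine ⟨𝓔.measurable_πU, Measure.ext_of_lintegral _ fun f hf => ?_⟩
  rw [lintegral_map hf 𝓔.measurable_πU, 𝓔.lintegral_πU f hf]

lemma EntropySpace.measurePreserving_πL_πR :
    MeasurePreserving (fun θ => (𝓔.πL θ, 𝓔.πR θ)) 𝓔.μ (𝓔.μ.prod 𝓔.μ) := by
  have := 𝓔.isProbabilityMeasure
  have hm := 𝓔.measurable_πL.prodMk 𝓔.measurable_πR
  refine ⟨hm, Measure.ext_of_lintegral _ fun g hg => ?_⟩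
  rw [lintegral_map hg hm, 𝓔.lintegral_πL_πR g hg, lintegral_prod_symm' g hg]

lemma EntropySpace.pair_πL_πR (θ : S) : 𝓔.pair (𝓔.πL θ) (𝓔.πR θ) = θ := by
  obtain ⟨⟨a, b⟩, rfl⟩ := 𝓔.pair_surjective θ
  simp only [𝓔.πL_pair, 𝓔.πR_pair]

lemma EntropySpace.measurePreserving_pair :
    MeasurePreserving (fun p : S × S => 𝓔.pair p.1 p.2) (𝓔.μ.prod 𝓔.μ) 𝓔.μ := by
  refine ⟨𝓔.measurable_pair, ?_⟩
  rw [← 𝓔.measurePreserving_πL_πR.map_eq,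
    Measure.map_map 𝓔.measurable_pair 𝓔.measurePreserving_πL_πR.measurable]
  have h : (fun p : S × S => 𝓔.pair p.1 p.2) ∘ (fun θ => (𝓔.πL θ, 𝓔.πR θ)) = id :=
    funext 𝓔.pair_πL_πR
  rw [h, Measure.map_id]

/-- Splitting the first of two independent entropies yields three independent entropies. -/
lemma EntropySpace.measurePreserving_split :
    MeasurePreserving (fun p : S × S => (𝓔.πL p.1, 𝓔.πR p.1, p.2)) (𝓔.μ.prod 𝓔.μ)
      (𝓔.μ.prod (𝓔.μ.prod 𝓔.μ)) := by
  have := 𝓔.isProbabilityMeasure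
  exact (measurePreserving_prodAssoc 𝓔.μ 𝓔.μ 𝓔.μ).comp
    (𝓔.measurePreserving_πL_πR.prod (.id 𝓔.μ))

lemma EntropySpace.measurePreserving_push :
    MeasurePreserving (fun p : S × S => (𝓔.πL p.1, 𝓔.pair (𝓔.πR p.1) p.2)) (𝓔.μ.prod 𝓔.μ)
      (𝓔.μ.prod 𝓔.μ) := by
  have := 𝓔.isProbabilityMeasure
  exact ((MeasurePreserving.id 𝓔.μ).prod 𝓔.measurePreserving_pair).comp
    𝓔.measurePreserving_split

lemma EntropySpace.measurePreserving_pop :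
    MeasurePreserving (fun p : S × S => (𝓔.πL p.2, 𝓔.πR p.2)) (𝓔.μ.prod 𝓔.μ)
      (𝓔.μ.prod 𝓔.μ) := by
  have := 𝓔.isProbabilityMeasure
  exact 𝓔.measurePreserving_πL_πR.comp measurePreserving_snd

lemma EntropySpace.measurePreserving_draw :
    MeasurePreserving (fun p : S × S => (𝓔.πU (𝓔.πL p.1), 𝓔.πR p.1, p.2)) (𝓔.μ.prod 𝓔.μ)
      ((volume : Measure unitInterval).prod (𝓔.μ.prod 𝓔.μ)) := by
  have := 𝓔.isProbabilityMeasure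
  exact (𝓔.measurePreserving_πU.prod (.id (𝓔.μ.prod 𝓔.μ))).comp 𝓔.measurePreserving_split

/-! ### Expectations over step-bounded runs -/

/-- The weighted value of `f` at the final state if the run from a configuration ends within `n`
steps, and zero otherwise. -/
def payoff (f : State N → ℝ≥0∞) (n : ℕ) (κ : Config L S) : ℝ≥0∞ :=
  ExtState.extend f ((advance 𝓔)^[n] κ).outcome * ((advance 𝓔)^[n] κ).weight

lemma payoff_succ (f : State N → ℝ≥0∞) (n : ℕ) (κ : Config L S) :
    payoff 𝓔 f (n + 1) κ = payoff 𝓔 f n (advance 𝓔 κ) := rfl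

lemma payoff_failed (f : State N → ℝ≥0∞) (n m : ℕ) (θ θK : S) :
    payoff 𝓔 f n (failed L θ θK m) = 0 := by
  induction n generalizing m with
  | zero => simp [payoff, failed]
  | succ n ih => exact ih (m + 1)

lemma sliceMeasurable_payoff {f : State N → ℝ≥0∞} (hf : Measurable f) (n : ℕ) :
    SliceMeasurable (payoff (L := L) 𝓔 f n) := by
  have h₁ := SliceMeasurable.outcome (L := L).iterate 𝓔 n
  have h₂ := SliceMeasurable.weight (L := L).iterate 𝓔 n
  have h₃ := ExtState.measurable_extend hf
  exact ⟨fun C K m => (h₃.comp (h₁.proper C K m)).mul (h₂.proper C K m).coe_nnreal_ennreal,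
    fun m => (h₃.comp (h₁.failed m)).mul (h₂.failed m).coe_nnreal_ennreal⟩

lemma lintegral_payoff {f : State N → ℝ≥0∞} (hf : Measurable f) (n : ℕ) (C : Prog L)
    (K : List (Prog L)) (σ : State N) (m : ℕ) (w : ℝ≥0) :
    ∫⁻ p, payoff 𝓔 f n ⟨p.1, C, K, .proper σ, p.2, m, w⟩ ∂(𝓔.μ.prod 𝓔.μ) =
      w * boundedWp f n C K σ := by
  have := 𝓔.isProbabilityMeasure
  induction n generalizing C K σ m w with
  | zero =>
    cases C <;> cases K <;>
      simp [payoff, boundedWp, Config.outcome, ExtState.extend, mul_comm]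
  | succ n ih =>
    have hmeas : ∀ (C : Prog L) K σ m w, Measurable fun p : S × S =>
        payoff 𝓔 f n ⟨p.1, C, K, .proper σ, p.2, m, w⟩ := fun C K σ m w =>
      (sliceMeasurable_payoff 𝓔 hf n).comp_proper C K m measurable_const measurable_fst
        measurable_snd measurable_const
    simp_rw [payoff_succ]
    cases C with
    | skip =>
      cases K with
      | nil => exact ih _ _ _ _ _
      | cons D K =>
        rw [boundedWp, ← ih D K σ (m + 1) w,
          ← 𝓔.measurePreserving_pop.lintegral_comp (hmeas D K σ (m + 1) w)]
        rfl
    | diverge => exact ih _ _ _ _ _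
    | assign x E => exact ih _ _ _ _ _
    | draw x =>
      have hdraw : Measurable fun p : unitInterval × S × S =>
          payoff 𝓔 f n ⟨p.2.1, (.skip : Prog L), K, .proper (σ.insert x (p.1 : ℝ)), p.2.2, m + 1, w⟩ :=
        (sliceMeasurable_payoff 𝓔 hf n).comp_proper _ _ _ ((State.measurable_insert x).comp
          (measurable_const.prodMk (measurable_subtype_coe.comp measurable_fst)))
          measurable_snd.fst measurable_snd.snd measurable_const
      have hb : Measurable fun v : ℝ => boundedWp f n (.skip : Prog L) K (σ.insert x v) :=
        (measurable_boundedWp hf n .skip K).comp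
          ((State.measurable_insert x).comp (measurable_const.prodMk measurable_id))
      calc _ = ∫⁻ p : unitInterval × S × S,
            payoff 𝓔 f n ⟨p.2.1, (.skip : Prog L), K, .proper (σ.insert x (p.1 : ℝ)), p.2.2, m + 1, w⟩
              ∂(volume.prod (𝓔.μ.prod 𝓔.μ)) :=
            𝓔.measurePreserving_draw.lintegral_comp hdraw
        _ = ∫⁻ v : unitInterval, w * boundedWp f n (.skip : Prog L) K (σ.insert x (v : ℝ)) := by
            rw [lintegral_prod _ hdraw.aemeasurable]
            exact lintegral_congr fun v => ih .skip K (σ.insert x (v : ℝ)) (m + 1) w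
        _ = w * ∫⁻ v : unitInterval, boundedWp f n (.skip : Prog L) K (σ.insert x (v : ℝ)) :=
            lintegral_const_mul _ (hb.comp measurable_subtype_coe)
        _ = _ := by
            rw [boundedWp]
            congr 1
            exact lintegral_subtype_comap measurableSet_Icc
              fun v => boundedWp f n (.skip : Prog L) K (σ.insert x v)
    | observe φ =>
      simp only [advance, advanceProper, boundedWp]
      split_ifs
      · exact ih _ _ _ _ _
      · simp [payoff_failed]
    | score E =>
      simp only [advance, advanceProper, boundedWp]
      split_ifs
      · rw [ih, ENNReal.coe_mul, mul_assoc]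
        rfl
      · simp [payoff_failed]
    | seq C D =>
      rw [boundedWp, ← ih _ _ σ (m + 1) w,
        ← 𝓔.measurePreserving_push.lintegral_comp (hmeas _ _ σ (m + 1) w)]
      rfl
    | cond φ C =>
      simp only [advance, advanceProper, boundedWp]
      split_ifs <;> exact ih _ _ _ _ _
    | loop φ C =>
      simp only [advance, advanceProper, boundedWp]
      split_ifs <;> exact ih _ _ _ _ _

/-! ### Independence of the dummy entropy -/

/-- Two entropy stacks agree on their topmost `n` entries. -/
def EntropySpace.Agree : ℕ → S → S → Prop
  | 0, _, _ => True
  | n + 1, a, b => 𝓔.πL a = 𝓔.πL b ∧ EntropySpace.Agree n (𝓔.πR a) (𝓔.πR b)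

lemma payoff_eq_of_agree (f : State N → ℝ≥0∞) (n : ℕ) (θ : S) (C : Prog L) (K : List (Prog L))
    (σ : State N) {a b : S} (h : 𝓔.Agree K.length a b) (m : ℕ) (w : ℝ≥0) :
    payoff 𝓔 f n ⟨θ, C, K, .proper σ, a, m, w⟩ = payoff 𝓔 f n ⟨θ, C, K, .proper σ, b, m, w⟩ := by
  induction n generalizing θ C K σ a b m w with
  | zero => cases C <;> cases K <;> rfl
  | succ n ih =>
    simp_rw [payoff_succ]
    cases C with
    | skip =>
      cases K with
      | nil => exact ih _ _ _ _ h _ _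
      | cons D K =>
        simp only [advance, advanceProper, h.1]
        exact ih _ _ _ _ h.2 _ _
    | diverge => exact ih _ _ _ _ h _ _
    | assign x E => exact ih _ _ _ _ h _ _
    | draw x => exact ih _ _ _ _ h _ _
    | seq C D =>
      refine ih _ _ _ _ ?_ _ _
      simpa [EntropySpace.Agree, 𝓔.πL_pair, 𝓔.πR_pair] using h
    | _ =>
      simp only [advance, advanceProper]
      split_ifs <;> first | exact ih _ _ _ _ h _ _ | simp only [payoff_failed]

lemma lintegral_payoff_initial {f : State N → ℝ≥0∞} (hf : Measurable f) (n : ℕ) (θK : S)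
    (C : Prog L) (σ : State N) :
    ∫⁻ θ, payoff 𝓔 f n (initial θK C (.proper σ) θ) ∂𝓔.μ = boundedWp f n C [] σ := by
  have := 𝓔.isProbabilityMeasure
  have hq := (sliceMeasurable_payoff 𝓔 hf n).measurable_initial θK C σ
  calc _ = ∫⁻ p, payoff 𝓔 f n (initial θK C (.proper σ) p.1) ∂(𝓔.μ.prod 𝓔.μ) :=
        ((measurePreserving_fst (μ := 𝓔.μ) (ν := 𝓔.μ)).lintegral_comp hq).symm
    _ = ∫⁻ p, payoff 𝓔 f n ⟨p.1, C, [], .proper σ, p.2, 0, 1⟩ ∂(𝓔.μ.prod 𝓔.μ) :=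
        lintegral_congr fun p => payoff_eq_of_agree 𝓔 f n p.1 C [] σ (a := θK) (b := p.2) trivial 0 1
    _ = boundedWp f n C [] σ := by rw [lintegral_payoff 𝓔 hf, ENNReal.coe_one, one_mul]

lemma monotone_payoff (f : State N → ℝ≥0∞) (κ : Config L S) :
    Monotone fun n => payoff 𝓔 f n κ := by
  intro m n hmn
  cases h : ((advance 𝓔)^[m] κ).outcome with
  | proper τ =>
    have hne : ((advance 𝓔)^[m] κ).outcome ≠ .div := by simp [h]
    simp only [payoff, outcome_iterate_of_le 𝓔 hmn hne, weight_iterate_of_le 𝓔 hmn h, le_refl]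
  | error => simp [payoff, h, ExtState.extend]
  | div => simp [payoff, h, ExtState.extend]

lemma iSup_payoff (f : State N → ℝ≥0∞) (θK : S) (C : Prog L) (σ : State N) (θ : S) :
    ⨆ n, payoff 𝓔 f n (initial θK C (.proper σ) θ) =
      runScore 𝓔 θK C (.proper σ) θ *
        ExtState.extend f (finalState 𝓔 θK C (.proper σ) θ) := by
  by_cases h : ∃ n τ, ((advance 𝓔)^[n] (initial θK C (.proper σ) θ)).outcome = .proper τ
  · obtain ⟨n, τ, hn⟩ := h
    have hne : ((advance 𝓔)^[n] (initial θK C (.proper σ) θ)).outcome ≠ .div := by simp [hn]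
    rw [finalState_of_outcome 𝓔 hne, runScore_of_outcome_proper 𝓔 hn, mul_comm]
    refine le_antisymm (iSup_le fun m => ?_)
      (le_iSup (fun n => payoff 𝓔 f n (initial θK C (.proper σ) θ)) n)
    refine (monotone_payoff 𝓔 f _ (le_max_left m n)).trans_eq ?_
    simp only [payoff]
    rw [outcome_iterate_of_le 𝓔 (le_max_right m n) hne,
      weight_iterate_of_le 𝓔 (le_max_right m n) hn]
  · push Not at h
    have hzero : ∀ n, payoff 𝓔 f n (initial θK C (.proper σ) θ) = 0 := fun n => by
      rw [payoff, ExtState.extend_eq_zero f, zero_mul]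
      rintro ⟨τ, hτ⟩
      exact h n τ hτ.symm
    simp only [hzero, iSup_const]
    rw [ExtState.extend_eq_zero f, mul_zero]
    rintro ⟨τ, hτ⟩
    by_cases hdiv : ∀ n, ((advance 𝓔)^[n] (initial θK C (.proper σ) θ)).outcome = .div
    · rw [finalState_of_forall_outcome 𝓔 hdiv] at hτ
      cases hτ
    · obtain ⟨n, hn⟩ := not_forall.1 hdiv
      exact h n τ (by rw [← finalState_of_outcome 𝓔 hn, hτ])

lemma lintegral_opMeasureProper {f : State N → ℝ≥0∞} (hf : Measurable f) (θK : S) (C : Prog L)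
    (σ : State N) :
    ∫⁻ τ, f τ ∂(opMeasureProper 𝓔 θK C (.proper σ)) = wp C f σ := by
  have hext := ExtState.measurable_extend hf
  have hfin := measurable_finalState 𝓔 θK C σ
  rw [opMeasureProper, lintegral_comap_proper, opMeasure, lintegral_map hext hfin, entropyMeasure,
    lintegral_withDensity_eq_lintegral_mul _ (measurable_runScore 𝓔 θK C σ).coe_nnreal_ennreal
      (g := fun θ => ExtState.extend f (finalState 𝓔 θK C (.proper σ) θ)) (hext.comp hfin)]
  simp only [Pi.mul_apply, ← iSup_payoff]
  rw [lintegral_iSup (fun n => (sliceMeasurable_payoff 𝓔 hf n).measurable_initial θK C σ)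
    fun m n hmn θ => monotone_payoff 𝓔 f _ hmn]
  simp_rw [lintegral_payoff_initial 𝓔 hf]
  exact iSup_boundedWp hf C σ

end

end PL

end

theorem theorem1 {N : Type*} [Countable N] [DecidableEq N] (L : PL.ExprLang N)
    {S : Type*} [MeasurableSpace S] (𝓔 : PL.EntropySpace S) (θK : S)
    (f : PL.State N → ℝ≥0∞) (hf : Measurable f) (C : PL.Prog L) (σ : PL.State N) :
    Measurable (PL.finalState 𝓔 θK C (.proper σ)) ∧
    Measurable (PL.runScore 𝓔 θK C (.proper σ)) ∧
    PL.wp C f σ = ∫⁻ τ, f τ ∂(PL.opMeasureProper 𝓔 θK C (.proper σ)) :=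
  ⟨PL.measurable_finalState 𝓔 θK C σ, PL.measurable_runScore 𝓔 θK C σ,
    (PL.lintegral_opMeasureProper 𝓔 hf θK C σ).symm⟩
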